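/- Let $N\ge 1$, let $\Omega\subset\mathbb R^N$ be a bounded open set, $T>0$, $Q_T=\Omega\times(0,T)$, and for a function $\gamma$ on $\Omega$ let $\mathbb K_\gamma=\{v\in H_0^1(\Omega): |\nabla v|\le \gamma \text{ a.e. in } \Omega\}$. Consider data $(\mathbf b,c,f,g,u_0)$ such that, for some $l\in\mathbb R$ and $m>0$, $$\mathbf b\in L^2(Q_T;\mathbb R^N),\quad c,f\in L^2(Q_T),\quad c-\tfrac12\nabla\cdot\mathbf b\ge l \text{ in the sense of distributions in } Q_T,$$ $$g\in W^{1,\infty}(0,T;L^\infty(\Omega)),\quad g\ge m \text{ a.e. in } Q_T,\quad u_0\in\mathbb K_{g(0)},$$ where $g\in W^{1,\infty}(0,T;L^\infty(\Omega))$ means $g,\partial_t g\in L^\infty(Q_T)$, and $g$ is identified with its representative in $C([0,T];L^\infty(\Omega))$. A solution for these data is a function $u\in L^\infty(0,T;W_0^{1,\infty}(\Omega))\cap C(\overline{Q_T})$ with $\partial_t u\in L^2(Q_T)$, $u(0)=u_0$, $u(t)\in\mathbb K_{g(t)}$ for a.e. $t\in(0,T)$, and, for a.e. $t\in(0,T)$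 and all $v\in\mathbb K_{g(t)}$, $$\int_\Omega \partial_t u(t)(v-u(t))+\int_\Omega \mathbf b(t)\cdot\nabla u(t)(v-u(t))+\int_\Omega c(t)u(t)(v-u(t))\ \ge\ \int_\Omega f(t)(v-u(t)).$$ **Theorem 3.2.** Given $\Omega$, $T$, $l\in\mathbb R$, $m>0$ and $M\ge0$, there is a constant $C>0$, depending only on these, with the following property. If, for $i=1,2$, the data $(\mathbf b_i,c_i,f_i,g_i,u_{0i})$ satisfy the above assumptions with these $l$ and $m$, if the norms of $\mathbf b_i,c_i,f_i$ in $L^2(Q_T)$ and of $g_i,\partial_t g_i$ in $L^\infty(Q_T)$ are at most $M$, and if $u_i$ is a solution for these data, then $$\|u_1-u_2\|^2_{L^\infty(0,T;L^2(\Omega))}\le C\Big(\|u_{01}-u_{02}\|^2_{L^2(\Omega)}+\|\mathbf b_1-\mathbf b_2\|_{L^1(Q_T)}+\|c_1-c_2\|_{L^1(Q_T)}+\|f_1-f_2\|_{L^1(Q_T)}+\|g_1-g_2\|_{L^\infty(Q_T)}\Big).$$ -/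

import Mathlib

open MeasureTheory Set Filter Topology
open scoped ENNReal NNReal ContDiff

noncomputable section

namespace GradVI

/-- The space `ℝ^N` with its Euclidean norm. -/
abbrev Space (N : ℕ) : Type := EuclideanSpace ℝ (Fin N)

/-- The space-time cylinder `Q_T = Ω × (0, T)`. -/
def cyl {N : ℕ} (Ω : Set (Space N)) (T : ℝ) : Set (Space N × ℝ) := Ω ×ˢ Ioo 0 T

/-- Lebesgue measure on `Ω`. -/
def muSpace {N : ℕ} (Ω : Set (Space N)) : Measure (Space N) := volume.restrict Ω

/-- Lebesgue measure on the time interval `(0, T)`. -/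
def muTime (T : ℝ) : Measure ℝ := volume.restrict (Ioo 0 T)

/-- Lebesgue measure on `Q_T`. -/
def muCyl {N : ℕ} (Ω : Set (Space N)) (T : ℝ) : Measure (Space N × ℝ) :=
  volume.restrict (cyl Ω T)

/-- `φ ∈ C_c^∞(U)`. -/
structure IsTest {F : Type*} [NormedAddCommGroup F] [NormedSpace ℝ F] (U : Set F)
    (φ : F → ℝ) : Prop where
  smooth : ContDiff ℝ ∞ φ
  compact_support : HasCompactSupport φ
  support_subset : tsupport φ ⊆ U

/-- `v ∈ H_0^1(Ω)` with weak gradient `G`: the pair `(v, G)` lies in the closure of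
`{(φ, ∇φ) : φ ∈ C_c^∞(Ω)}` in `L²(Ω) × L²(Ω; ℝ^N)`. -/
structure HasH10Gradient {N : ℕ} (Ω : Set (Space N)) (v : Space N → ℝ)
    (G : Space N → Space N) : Prop where
  memLp : MemLp v 2 (muSpace Ω)
  memLp_grad : MemLp G 2 (muSpace Ω)
  approx : ∃ φ : ℕ → Space N → ℝ, (∀ n, IsTest Ω (φ n)) ∧
    Tendsto (fun n => eLpNorm (fun x => φ n x - v x) 2 (muSpace Ω)) atTop (𝓝 0) ∧
    Tendsto (fun n => eLpNorm (fun x => gradient (φ n) x - G x) 2 (muSpace Ω)) atTop (𝓝 0)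

/-- The convex set `K_γ = {v ∈ H_0^1(Ω) : |∇v| ≤ γ a.e. in Ω}`. -/
def gradConvex {N : ℕ} (Ω : Set (Space N)) (γ : Space N → ℝ) : Set (Space N → ℝ) :=
  {v | ∃ G : Space N → Space N, HasH10Gradient Ω v G ∧ ∀ᵐ x ∂(muSpace Ω), ‖G x‖ ≤ γ x}

/-- `w' = ∂_t w` in the sense of distributions in `Q_T`. -/
def HasWeakTimeDeriv {N : ℕ} (Ω : Set (Space N)) (T : ℝ) (w w' : Space N × ℝ → ℝ) : Prop :=
  ∀ φ : Space N × ℝ → ℝ, IsTest (cyl Ω T) φ →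
    ∫ z, w z * deriv (fun t => φ (z.1, t)) z.2 ∂(muCyl Ω T) = -∫ z, w' z * φ z ∂(muCyl Ω T)

/-- `g ∈ W^{1,∞}(0, T; L^∞(Ω))` with `∂_t g = g'`, where `g` is the representative that is
continuous from `[0, T]` to `L^∞(Ω)`, so that `g(0)` has a meaning. -/
structure IsW1Inf {N : ℕ} (Ω : Set (Space N)) (T : ℝ) (g g' : Space N × ℝ → ℝ) : Prop where
  memLp : MemLp g ∞ (muCyl Ω T)
  memLp_deriv : MemLp g' ∞ (muCyl Ω T)
  weakDeriv : HasWeakTimeDeriv Ω T g g'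
  continuous_time : ∀ s ∈ Icc 0 T,
    Tendsto (fun t => eLpNorm (fun x => g (x, t) - g (x, s)) ∞ (muSpace Ω))
      (𝓝[Icc 0 T] s) (𝓝 0)

/-- `c - ½ ∇ · b ≥ l` in the sense of distributions in `Q_T`. -/
def WeaklyCoercive {N : ℕ} (Ω : Set (Space N)) (T l : ℝ) (b : Space N × ℝ → Space N)
    (c : Space N × ℝ → ℝ) : Prop :=
  ∀ φ : Space N × ℝ → ℝ, IsTest (cyl Ω T) φ → (∀ z, 0 ≤ φ z) →
    l * ∫ z, φ z ∂(muCyl Ω T) ≤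
      ∫ z, (c z * φ z + (1 / 2) * inner ℝ (b z) (gradient (fun y => φ (y, z.2)) z.1))
        ∂(muCyl Ω T)

/-- The data of the problem; `gt` is the time derivative of the threshold `g`. -/
structure Data (N : ℕ) where
  b : Space N × ℝ → Space N
  c : Space N × ℝ → ℝ
  f : Space N × ℝ → ℝ
  g : Space N × ℝ → ℝ
  gt : Space N × ℝ → ℝ
  u0 : Space N → ℝ

/-- The assumptions on the data, with lower bounds `l` and `m`. -/
structure Data.Admissible {N : ℕ} (d : Data N) (Ω : Set (Space N)) (T l m : ℝ) : Prop where
  b_memLp : MemLp d.b 2 (muCyl Ω T)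
  c_memLp : MemLp d.c 2 (muCyl Ω T)
  coercive : WeaklyCoercive Ω T l d.b d.c
  f_memLp : MemLp d.f 2 (muCyl Ω T)
  u0_mem : d.u0 ∈ gradConvex Ω (fun x => d.g (x, 0))
  g_W1Inf : IsW1Inf Ω T d.g d.gt
  g_lower : ∀ᵐ z ∂(muCyl Ω T), m ≤ d.g z

/-- The norms of `b`, `c`, `f` in `L²(Q_T)` and those of `g`, `∂_t g` in `L^∞(Q_T)` are at
most `M`. -/
structure Data.BoundedBy {N : ℕ} (d : Data N) (Ω : Set (Space N)) (T : ℝ) (M : ℝ≥0) :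
    Prop where
  b_le : eLpNorm d.b 2 (muCyl Ω T) ≤ M
  c_le : eLpNorm d.c 2 (muCyl Ω T) ≤ M
  f_le : eLpNorm d.f 2 (muCyl Ω T) ≤ M
  g_le : eLpNorm d.g ∞ (muCyl Ω T) ≤ M
  gt_le : eLpNorm d.gt ∞ (muCyl Ω T) ≤ M

/-- `u`, with spatial gradient `Du` and time derivative `ut`, solves the variational inequality
with data `d`, in the class `L^∞(0, T; W_0^{1,∞}(Ω)) ∩ C(closure of Q_T)`, `∂_t u ∈ L²(Q_T)`. -/
structure IsSolutionWith {N : ℕ} (Ω : Set (Space N)) (T : ℝ) (d : Data N)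
    (u : Space N × ℝ → ℝ) (Du : Space N × ℝ → Space N) (ut : Space N × ℝ → ℝ) : Prop where
  continuousOn : ContinuousOn u (closure Ω ×ˢ Icc 0 T)
  grad_memLp : MemLp Du ∞ (muCyl Ω T)
  grad : ∀ᵐ t ∂(muTime T), HasH10Gradient Ω (fun x => u (x, t)) (fun x => Du (x, t))
  deriv_memLp : MemLp ut 2 (muCyl Ω T)
  weakDeriv : HasWeakTimeDeriv Ω T u ut
  mem_convex : ∀ᵐ t ∂(muTime T), (fun x => u (x, t)) ∈ gradConvex Ω (fun x => d.g (x, t))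
  initial : ∀ᵐ x ∂(muSpace Ω), u (x, 0) = d.u0 x
  ineq : ∀ᵐ t ∂(muTime T), ∀ v ∈ gradConvex Ω (fun x => d.g (x, t)),
    ∫ x, d.f (x, t) * (v x - u (x, t)) ∂(muSpace Ω) ≤
      ∫ x, ut (x, t) * (v x - u (x, t)) ∂(muSpace Ω)
        + ∫ x, inner ℝ (d.b (x, t)) (Du (x, t)) * (v x - u (x, t)) ∂(muSpace Ω)
        + ∫ x, d.c (x, t) * u (x, t) * (v x - u (x, t)) ∂(muSpace Ω)

/-- `u` is a solution of the variational inequality with data `d`. -/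
def IsSolution {N : ℕ} (Ω : Set (Space N)) (T : ℝ) (d : Data N) (u : Space N × ℝ → ℝ) : Prop :=
  ∃ (Du : Space N × ℝ → Space N) (ut : Space N × ℝ → ℝ), IsSolutionWith Ω T d u Du ut

/-- The norm of `L^∞(0, T; L²(Ω))`. -/
def normLinfL2 {N : ℕ} (Ω : Set (Space N)) (T : ℝ) (w : Space N × ℝ → ℝ) : ℝ≥0∞ :=
  essSup (fun t => eLpNorm (fun x => w (x, t)) 2 (muSpace Ω)) (muTime T)

end GradVI

end

open GradVI

/-! The obstacle to comparing two solutions is that `u₂` is not admissible in the inequality for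
`u₁`, because its gradient is bounded by `g₂` and not by `g₁`. With `β = ‖g₁ - g₂‖_∞` and `λ = m /
(m + β)`, the bound `g₁ ≥ m` gives `λ (g₁ + β) ≤ g₁`. Hence `λ u₂` is admissible for the first
problem and `λ u₁` for the second (`Data.Admissible.smul_mem_gradConvex`).

Let `rᵢ` be the residual of `uᵢ` and `w = u₁ - u₂`. Adding the two tested inequalities gives `λ ∫
(r₁ - r₂) w + (1 - λ) ∫ (r₁ u₁ + r₂ u₂) ≤ 0`, where `1 - λ = λ β / m`. In the first integral `∂ₜw ·
w` is half the derivative of `w²` and `b₁ · ∇w w + c₁ w²` is at least `l w²` after integration,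
which is the distributional condition tested with `w²`. What remains is linear in the differences of
the data. The second integral is bounded below by a constant, and no bound on `∂ₜuᵢ` enters, since
`∂ₜuᵢ uᵢ` is also an exact derivative. Gronwall's lemma concludes (`energy_inequality`,
`le_mul_exp_of_le_add_integral`).

The differences of `b`, `c`, `f` enter through `L¹` norms because the solutions and their gradients
are uniformly bounded: `|∇u| ≤ g ≤ M` by uniqueness of the weak gradient, and `|u| ≤ 2RM` on a set
inside a ball of radius `R` (`HasH10Gradient.abs_le`). The analytic work lies in the chain rule
`integral_sq_sub_integral_sq`, and in localising the coercivity condition to almost every time and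
extending it to `w²` (`WeaklyCoercive.ae_nonneg`, `HasH10Gradient.exists_nonneg_test_tendsto_sq`).
-/

namespace GradVI

/-! ### Measures, test functions and their gradients. -/

section Measures

variable {N : ℕ} {Ω : Set (Space N)} {T : ℝ}

theorem muCyl_eq_prod (Ω : Set (Space N)) (T : ℝ) :
    muCyl Ω T = (muSpace Ω).prod (muTime T) := by
  rw [muCyl, cyl, Measure.volume_eq_prod, ← Measure.prod_restrict]
  rfl

instance isFiniteMeasure_muTime (T : ℝ) : IsFiniteMeasure (muTime T) :=
  ⟨by simp [muTime]⟩

theorem isFiniteMeasure_muSpace (hΩb : Bornology.IsBounded Ω) : IsFiniteMeasure (muSpace Ω) :=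
  ⟨by simpa [muSpace] using hΩb.measure_lt_top⟩

instance sFinite_muSpace (Ω : Set (Space N)) : SFinite (muSpace Ω) := by
  unfold muSpace; infer_instance

instance isLocallyFiniteMeasure_muSpace (Ω : Set (Space N)) :
    IsLocallyFiniteMeasure (muSpace Ω) := by
  unfold muSpace; infer_instance

end Measures

section Test

variable {F : Type*} [NormedAddCommGroup F] [NormedSpace ℝ F] {U : Set F} {φ ψ : F → ℝ}

theorem IsTest.sub (hφ : IsTest U φ) (hψ : IsTest U ψ) : IsTest U (fun x => φ x - ψ x) where
  smooth := hφ.smooth.sub hψ.smooth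
  compact_support := hφ.compact_support.sub hψ.compact_support
  support_subset :=
    (tsupport_sub φ ψ).trans (union_subset hφ.support_subset hψ.support_subset)

theorem IsTest.const_mul (r : ℝ) (hφ : IsTest U φ) : IsTest U (fun x => r * φ x) where
  smooth := contDiff_const.mul hφ.smooth
  compact_support := hφ.compact_support.mul_left
  support_subset := (tsupport_mul_subset_right (f := fun _ => r)).trans hφ.support_subset

theorem IsTest.comp {η : ℝ → ℝ} (hη : ContDiff ℝ ∞ η) (h0 : η 0 = 0) (hφ : IsTest U φ) :
    IsTest U (fun x => η (φ x)) where
  smooth := hη.comp hφ.smooth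
  compact_support := hφ.compact_support.comp_left h0
  support_subset := (tsupport_comp_subset h0 φ).trans hφ.support_subset

theorem IsTest.eq_zero (hφ : IsTest U φ) {x : F} (hx : x ∉ U) : φ x = 0 :=
  image_eq_zero_of_notMem_tsupport fun h => hx (hφ.support_subset h)

end Test

section Gradient

variable {N : ℕ} {Ω : Set (Space N)} {φ ψ : Space N → ℝ}

theorem norm_gradient (φ : Space N → ℝ) (x : Space N) : ‖gradient φ x‖ = ‖fderiv ℝ φ x‖ := by
  simp [gradient]

theorem IsTest.hasGradientAt (hφ : IsTest Ω φ) (x : Space N) :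
    HasGradientAt φ (gradient φ x) x :=
  (hφ.smooth.differentiable (by simp) x).hasGradientAt

theorem IsTest.continuous_gradient (hφ : IsTest Ω φ) : Continuous (gradient φ) := by
  unfold gradient
  exact (LinearIsometryEquiv.continuous _).comp (hφ.smooth.continuous_fderiv (by simp))

theorem IsTest.gradient_eq_zero (hφ : IsTest Ω φ) {x : Space N} (hx : x ∉ Ω) :
    gradient φ x = 0 := by
  have : fderiv ℝ φ x = 0 := by
    by_contra h
    exact hx (hφ.support_subset (support_fderiv_subset ℝ h))
  simp [gradient, this]

theorem IsTest.hasCompactSupport_gradient (hφ : IsTest Ω φ) : HasCompactSupport (gradient φ) := by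
  have := hφ.compact_support.fderiv (𝕜 := ℝ)
  exact this.comp_left (g := fun L => (InnerProductSpace.toDual ℝ (Space N)).symm L) (map_zero _)

theorem IsTest.gradient_sub (hφ : IsTest Ω φ) (hψ : IsTest Ω ψ) (x : Space N) :
    gradient (fun x => φ x - ψ x) x = gradient φ x - gradient ψ x := by
  refine HasGradientAt.gradient ?_
  have h1 := (hφ.hasGradientAt x).hasFDerivAt
  have h2 := (hψ.hasGradientAt x).hasFDerivAt
  rw [hasGradientAt_iff_hasFDerivAt, map_sub]
  exact h1.sub h2

theorem IsTest.gradient_comp {η : ℝ → ℝ} (hη : Differentiable ℝ η) (hφ : IsTest Ω φ)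
    (x : Space N) :
    gradient (fun x => η (φ x)) x = deriv η (φ x) • gradient φ x := by
  refine HasGradientAt.gradient ?_
  have h1 := (hφ.hasGradientAt x).hasFDerivAt
  rw [hasGradientAt_iff_hasFDerivAt, map_smul]
  exact (hη (φ x)).hasDerivAt.comp_hasFDerivAt x h1

theorem IsTest.memLp (hφ : IsTest Ω φ) (p : ℝ≥0∞) : MemLp φ p (muSpace Ω) :=
  (hφ.smooth.continuous.memLp_of_hasCompactSupport hφ.compact_support).restrict _

theorem IsTest.memLp_gradient (hφ : IsTest Ω φ) (p : ℝ≥0∞) :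
    MemLp (gradient φ) p (muSpace Ω) :=
  (hφ.continuous_gradient.memLp_of_hasCompactSupport hφ.hasCompactSupport_gradient).restrict _

end Gradient

/-! ### Pairings in `L²`. -/

section L2

variable {α E : Type*} [MeasurableSpace α] {μ : Measure α} [NormedAddCommGroup E]
  [InnerProductSpace ℝ E]

theorem integrable_inner_of_memLp {G H : α → E} (hG : MemLp G 2 μ) (hH : MemLp H 2 μ) :
    Integrable (fun x => inner ℝ (G x) (H x)) μ :=
  memLp_one_iff_integrable.1 (hG.of_bilin (fun a b => inner ℝ a b) 1 hH (hG.1.inner hH.1)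
    (Eventually.of_forall fun x => by
      simpa using nnnorm_inner_le_nnnorm (𝕜 := ℝ) (G x) (H x)))

theorem eLpNorm_inner_le {G H : α → E} (hG : AEStronglyMeasurable G μ)
    (hH : AEStronglyMeasurable H μ) :
    eLpNorm (fun x => inner ℝ (G x) (H x)) 1 μ ≤ eLpNorm G 2 μ * eLpNorm H 2 μ := by
  have := eLpNorm_le_eLpNorm_mul_eLpNorm_of_nnnorm (p := 2) (q := 2) (r := 1) hG hH
    (fun a b => inner ℝ a b) 1
    (Eventually.of_forall fun x => by
      simpa using nnnorm_inner_le_nnnorm (𝕜 := ℝ) (G x) (H x))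
  simpa only [ENNReal.coe_one, one_mul] using this

theorem tendsto_integral_inner_of_tendsto_eLpNorm {F : ℕ → α → E} {G H : α → E}
    (hF : ∀ n, MemLp (F n) 2 μ) (hG : MemLp G 2 μ) (hH : MemLp H 2 μ)
    (h : Tendsto (fun n => eLpNorm (fun x => F n x - G x) 2 μ) atTop (𝓝 0)) :
    Tendsto (fun n => ∫ x, inner ℝ (F n x) (H x) ∂μ) atTop (𝓝 (∫ x, inner ℝ (G x) (H x) ∂μ)) := by
  have h2 : Tendsto (fun n => eLpNorm (fun x => F n x - G x) 2 μ * eLpNorm H 2 μ) atTop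
      (𝓝 (0 * eLpNorm H 2 μ)) :=
    ENNReal.Tendsto.mul_const h (Or.inr hH.2.ne)
  rw [zero_mul] at h2
  have h3 : ∀ n, eLpNorm ((fun x => inner ℝ (F n x) (H x)) - fun x => inner ℝ (G x) (H x)) 1 μ ≤
      eLpNorm (fun x => F n x - G x) 2 μ * eLpNorm H 2 μ := by
    intro n
    have := eLpNorm_inner_le ((hF n).1.sub hG.1) hH.1
    have he : ((fun x => inner ℝ (F n x) (H x)) - fun x => inner ℝ (G x) (H x)) =
        fun x => inner ℝ ((F n - G) x) (H x) := by
      funext x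
      rw [Pi.sub_apply, Pi.sub_apply, inner_sub_left]
    rw [he]
    exact this
  exact tendsto_integral_of_L1' (fun x => inner ℝ (G x) (H x)) (integrable_inner_of_memLp hG hH).1
    (Eventually.of_forall fun n => integrable_inner_of_memLp (hF n) hH)
    (tendsto_of_tendsto_of_tendsto_of_le_of_le tendsto_const_nhds h2 (fun _ => zero_le) h3)

end L2

/-! ### Algebra of `H₀¹` gradients and their uniqueness. -/

section H10

variable {N : ℕ} {Ω : Set (Space N)} {v v₁ v₂ : Space N → ℝ} {G G₁ G₂ : Space N → Space N}

theorem HasH10Gradient.sub (h₁ : HasH10Gradient Ω v₁ G₁) (h₂ : HasH10Gradient Ω v₂ G₂) :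
    HasH10Gradient Ω (fun x => v₁ x - v₂ x) (fun x => G₁ x - G₂ x) := by
  obtain ⟨φ, hφ, hφv, hφG⟩ := h₁.approx
  obtain ⟨ψ, hψ, hψv, hψG⟩ := h₂.approx
  refine ⟨h₁.memLp.sub h₂.memLp, h₁.memLp_grad.sub h₂.memLp_grad, fun n x => φ n x - ψ n x,
    fun n => (hφ n).sub (hψ n), ?_, ?_⟩
  · have := hφv.add hψv
    rw [add_zero] at this
    refine tendsto_of_tendsto_of_tendsto_of_le_of_le tendsto_const_nhds this
      (fun _ => zero_le) fun n => ?_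
    refine le_trans (le_of_eq ?_) (eLpNorm_sub_le (((hφ n).memLp 2).sub h₁.memLp).1
      (((hψ n).memLp 2).sub h₂.memLp).1 (by norm_num))
    congr 1; ext x; simp; ring
  · have := hφG.add hψG
    rw [add_zero] at this
    refine tendsto_of_tendsto_of_tendsto_of_le_of_le tendsto_const_nhds this
      (fun _ => zero_le) fun n => ?_
    refine le_trans (le_of_eq ?_) (eLpNorm_sub_le (((hφ n).memLp_gradient 2).sub h₁.memLp_grad).1
      (((hψ n).memLp_gradient 2).sub h₂.memLp_grad).1 (by norm_num))
    congr 1; ext1 x; simp only [(hφ n).gradient_sub (hψ n), Pi.sub_apply]; abel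

theorem HasH10Gradient.const_mul (r : ℝ) (h : HasH10Gradient Ω v G) :
    HasH10Gradient Ω (fun x => r * v x) (fun x => r • G x) := by
  obtain ⟨φ, hφ, hφv, hφG⟩ := h.approx
  refine ⟨h.memLp.const_mul r, h.memLp_grad.const_smul r, fun n x => r * φ n x,
    fun n => (hφ n).const_mul r, ?_, ?_⟩
  · have := ENNReal.Tendsto.const_mul (a := ‖r‖ₑ) hφv (Or.inr (by simp))
    rw [mul_zero] at this
    refine this.congr fun n => ?_
    rw [← eLpNorm_const_smul]
    congr 1; ext x; simp; ring
  · have := ENNReal.Tendsto.const_mul (a := ‖r‖ₑ) hφG (Or.inr (by simp))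
    rw [mul_zero] at this
    refine this.congr fun n => ?_
    rw [← eLpNorm_const_smul]
    congr 1; ext1 x
    have : gradient (fun x => r * φ n x) x = r • gradient (φ n) x := by
      have := (hφ n).gradient_comp (η := fun s => r * s) (by fun_prop) x
      rw [this]
      congr 1
      simp
    rw [this]
    simp [smul_sub]

/-- Test functions tending to `0` in `L²` have gradients tending to `0` as distributions, by
integration by parts, so an `L²` limit of these gradients must vanish. -/
theorem HasH10Gradient.ae_eq_zero (hΩ : IsOpen Ω) (h : HasH10Gradient Ω (fun _ => 0) G) :
    ∀ᵐ x ∂(muSpace Ω), G x = 0 := by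
  obtain ⟨φ, hφ, hφv, hφG⟩ := h.approx
  have key : ∀ᵐ x ∂(volume : Measure (Space N)), x ∈ Ω → G x = 0 := by
    refine hΩ.ae_eq_zero_of_integral_contDiff_smul_eq_zero ?_ ?_
    · exact locallyIntegrableOn_of_locallyIntegrable_restrict (h.memLp_grad.locallyIntegrable (by norm_num))
    · intro ψ hψs hψc hψΩ
      have hψ : IsTest Ω ψ := ⟨hψs, hψc, hψΩ⟩
      have hGψ : Integrable (fun x => ψ x • G x) (muSpace Ω) := by
        exact (memLp_one_iff_integrable.1 (h.memLp_grad.smul (r := 1) (hψ.memLp 2)))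
      have hres : ∫ x, ψ x • G x = ∫ x, ψ x • G x ∂(muSpace Ω) := by
        refine (setIntegral_eq_integral_of_forall_compl_eq_zero fun x hx => ?_).symm
        rw [hψ.eq_zero hx, zero_smul]
      rw [hres]
      refine ext_inner_right ℝ fun e => ?_
      rw [inner_zero_left, real_inner_comm, ← integral_inner hGψ]
      have hψe : MemLp (fun x => ψ x • e) 2 (muSpace Ω) := by
        have hc : Continuous fun x => ψ x • e := hψs.continuous.smul continuous_const
        exact (hc.memLp_of_hasCompactSupport hψc.smul_right).restrict _
      have hψe' : MemLp (fun x => fderiv ℝ ψ x e) 2 (muSpace Ω) := by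
        have hc : Continuous fun x => fderiv ℝ ψ x e :=
          (hψs.continuous_fderiv (by simp)).clm_apply continuous_const
        exact (hc.memLp_of_hasCompactSupport (hψc.fderiv_apply ℝ e)).restrict _
      -- The same sequence of integrals has two limits: `∫ ψ G · e` as it stands, and `0` once the
      -- derivative has been moved onto `ψ`.
      have lim1 := tendsto_integral_inner_of_tendsto_eLpNorm (fun n => (hφ n).memLp_gradient 2)
        h.memLp_grad hψe hφG
      have lim2 := tendsto_integral_inner_of_tendsto_eLpNorm (fun n => (hφ n).memLp 2)
        h.memLp hψe' hφv
      have lim2' := lim2.neg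
      have hlim0 : -∫ x, inner ℝ ((fun _ : Space N => (0 : ℝ)) x) (fderiv ℝ ψ x e) ∂(muSpace Ω)
          = 0 := by simp
      rw [hlim0] at lim2'
      have heq : ∀ n, ∫ x, inner ℝ (gradient (φ n) x) (ψ x • e) ∂(muSpace Ω) =
          -∫ x, inner ℝ (φ n x) (fderiv ℝ ψ x e) ∂(muSpace Ω) := by
        intro n
        have h1 : ∫ x, inner ℝ (gradient (φ n) x) (ψ x • e) ∂(muSpace Ω) =
            ∫ x, fderiv ℝ (φ n) x e * ψ x := by
          rw [muSpace, setIntegral_eq_integral_of_forall_compl_eq_zero]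
          · congr 1; ext x
            rw [inner_smul_right, inner_gradient_left, mul_comm]
          · intro x hx; simp [hψ.eq_zero hx]
        have h2 : ∫ x, inner ℝ (φ n x) (fderiv ℝ ψ x e) ∂(muSpace Ω) =
            ∫ x, φ n x * fderiv ℝ ψ x e := by
          rw [muSpace, setIntegral_eq_integral_of_forall_compl_eq_zero]
          · congr 1; ext x
            simp [mul_comm]
          · intro x hx; simp [(hφ n).eq_zero hx]
        rw [h1, h2]
        have hc := (hφ n).smooth
        rw [integral_mul_fderiv_eq_neg_fderiv_mul_of_integrable, neg_neg]
        · refine Continuous.integrable_of_hasCompactSupport ?_ ?_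
          · exact ((hc.continuous_fderiv (by simp)).clm_apply continuous_const).mul hψs.continuous
          · exact hψc.mul_left
        · refine Continuous.integrable_of_hasCompactSupport ?_ ?_
          · exact hc.continuous.mul ((hψs.continuous_fderiv (by simp)).clm_apply continuous_const)
          · exact (hφ n).compact_support.mul_right
        · refine Continuous.integrable_of_hasCompactSupport ?_ ?_
          · exact hc.continuous.mul hψs.continuous
          · exact hψc.mul_left
        · exact fun x _ => hc.differentiable (by simp) x
        · exact fun x _ => hψs.differentiable (by simp) x
      have := tendsto_nhds_unique (lim1.congr heq) lim2'
      rw [← this]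
      congr 1; ext x
      rw [inner_smul_right, inner_smul_right, real_inner_comm]
  rw [muSpace, ae_restrict_iff' hΩ.measurableSet]
  exact key

theorem HasH10Gradient.ae_eq (hΩ : IsOpen Ω) (h₁ : HasH10Gradient Ω v G₁)
    (h₂ : HasH10Gradient Ω v G₂) : ∀ᵐ x ∂(muSpace Ω), G₁ x = G₂ x := by
  have h := h₁.sub h₂
  simp only [sub_self] at h
  filter_upwards [h.ae_eq_zero hΩ] with x hx
  exact sub_eq_zero.1 hx

end H10

end GradVI

namespace GradVI

/-! ### Sup bound for `H₀¹` functions with bounded gradient. -/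

section SupBound

variable {N : ℕ} {Ω : Set (Space N)}

/-- Starting in a ball of radius `R`, a segment of length `2R` leaves it, so `φ` vanishes at its end
and the fundamental theorem of calculus bounds `φ x`. The estimate is for the excess over `L`,
because functions approximating `v` satisfy the gradient bound of `v` only in the limit. -/
theorem IsTest.ofReal_abs_sub_le {φ : Space N → ℝ} (hφ : IsTest Ω φ) {R : ℝ} (hR : 0 ≤ R)
    (hΩR : Ω ⊆ Metric.ball 0 R) {e : Space N} (he : ‖e‖ = 1) (L : ℝ) {x : Space N} (hx : x ∈ Ω) :
    ENNReal.ofReal (|φ x| - 2 * R * L) ≤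
      ∫⁻ s in Ioc 0 (2 * R), ENNReal.ofReal (‖gradient φ (x - s • e)‖ - L) := by
  have hderiv : ∀ s : ℝ, HasDerivAt (fun s : ℝ => φ (x - s • e))
      (fderiv ℝ φ (x - s • e) (-e)) s := by
    intro s
    have h1 : HasDerivAt (fun s : ℝ => x - s • e) (-e) s := by
      simpa using ((hasDerivAt_id s).smul_const e).const_sub x
    exact (hφ.smooth.differentiable (by simp) _).hasFDerivAt.comp_hasDerivAt s h1
  have hline : Continuous fun s : ℝ => x - s • e := by fun_prop
  have hcont : Continuous fun s : ℝ => fderiv ℝ φ (x - s • e) (-e) :=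
    ((hφ.smooth.continuous_fderiv (by simp)).comp hline).clm_apply continuous_const
  have hcg : Continuous fun s : ℝ => ‖gradient φ (x - s • e)‖ :=
    (hφ.continuous_gradient.comp hline).norm
  have hftc := intervalIntegral.integral_eq_sub_of_hasDerivAt (a := 0) (b := 2 * R)
    (fun s _ => hderiv s) (hcont.intervalIntegrable _ _)
  have hout : x - (2 * R) • e ∉ Ω := by
    intro h
    have h1 := mem_ball_zero_iff.1 (hΩR h)
    have h2 := mem_ball_zero_iff.1 (hΩR hx)
    have h3 : ‖(2 * R) • e‖ ≤ ‖x‖ + ‖x - (2 * R) • e‖ := by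
      have := norm_sub_le x (x - (2 * R) • e)
      simpa using this
    rw [norm_smul, he, Real.norm_of_nonneg (by positivity)] at h3
    linarith
  rw [hφ.eq_zero hout] at hftc
  simp only [zero_smul, sub_zero, zero_sub] at hftc
  have hle : |φ x| ≤ ∫ s in (0 : ℝ)..2 * R, ‖gradient φ (x - s • e)‖ := by
    rw [← abs_neg, ← hftc, ← Real.norm_eq_abs]
    refine intervalIntegral.norm_integral_le_of_norm_le (by positivity)
      (Eventually.of_forall fun s _ => ?_) (hcg.intervalIntegrable _ _)
    rw [norm_gradient]
    simpa [he] using (fderiv ℝ φ (x - s • e)).le_opNorm (-e)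
  have hcm : Continuous fun s : ℝ => max (‖gradient φ (x - s • e)‖ - L) 0 :=
    (hcg.sub continuous_const).max continuous_const
  have hle2 : |φ x| - 2 * R * L ≤
      ∫ s in (0 : ℝ)..2 * R, max (‖gradient φ (x - s • e)‖ - L) 0 := by
    have h1 : ∫ s in (0 : ℝ)..2 * R, (‖gradient φ (x - s • e)‖ - L) ≤
        ∫ s in (0 : ℝ)..2 * R, max (‖gradient φ (x - s • e)‖ - L) 0 :=
      intervalIntegral.integral_mono_on (by positivity)
        ((hcg.sub continuous_const).intervalIntegrable _ _) (hcm.intervalIntegrable _ _)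
        fun s _ => le_max_left _ _
    rw [intervalIntegral.integral_sub (hcg.intervalIntegrable _ _)
      (continuous_const.intervalIntegrable _ _)] at h1
    simp only [intervalIntegral.integral_const, sub_zero, smul_eq_mul] at h1
    linarith
  refine (ENNReal.ofReal_le_ofReal hle2).trans (le_of_eq ?_)
  rw [intervalIntegral.integral_of_le (by positivity), ofReal_integral_eq_lintegral_ofReal]
  · congr 1; ext s
    rcases le_total (‖gradient φ (x - s • e)‖ - L) 0 with h | h
    · rw [max_eq_right h, ENNReal.ofReal_of_nonpos h, ENNReal.ofReal_zero]
    · rw [max_eq_left h]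
  · exact (hcm.integrableOn_Icc).mono_set Ioc_subset_Icc_self
  · exact Eventually.of_forall fun s => le_max_right _ _

/-- The pointwise bound is integrated with Tonelli; translation invariance makes each shift `s`
contribute equally. Since `0 ≤ L`, the excess is zero outside `Ω`, where the gradient vanishes. -/
theorem IsTest.lintegral_ofReal_abs_sub_le (hN : 1 ≤ N) {φ : Space N → ℝ} (hφ : IsTest Ω φ)
    {R : ℝ} (hR : 0 ≤ R) (hΩ : MeasurableSet Ω) (hΩR : Ω ⊆ Metric.ball 0 R) {L : ℝ} (hL : 0 ≤ L) :
    ∫⁻ x, ENNReal.ofReal (|φ x| - 2 * R * L) ∂(muSpace Ω) ≤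
      ENNReal.ofReal (2 * R) *
        ∫⁻ x, ENNReal.ofReal (‖gradient φ x‖ - L) ∂(muSpace Ω) := by
  set e : Space N := EuclideanSpace.single ⟨0, hN⟩ 1
  have he : ‖e‖ = 1 := by simp [e]
  set h : Space N → ℝ≥0∞ := fun x => ENNReal.ofReal (‖gradient φ x‖ - L)
  have hh : Measurable h := by
    have := hφ.continuous_gradient.norm.measurable
    fun_prop
  calc ∫⁻ x, ENNReal.ofReal (|φ x| - 2 * R * L) ∂(muSpace Ω)
      ≤ ∫⁻ x, (∫⁻ s in Ioc 0 (2 * R), h (x - s • e)) ∂(muSpace Ω) := by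
        refine setLIntegral_mono' hΩ fun x hx => ?_
        exact hφ.ofReal_abs_sub_le hR hΩR he L hx
    _ ≤ ∫⁻ x, ∫⁻ s in Ioc 0 (2 * R), h (x - s • e) :=
        lintegral_mono' Measure.restrict_le_self le_rfl
    _ = ∫⁻ s in Ioc 0 (2 * R), ∫⁻ x, h (x - s • e) := by
        refine lintegral_lintegral_swap ?_
        refine Measurable.aemeasurable ?_
        exact hh.comp (by fun_prop)
    _ = ∫⁻ s in Ioc 0 (2 * R), ∫⁻ x, h x := by
        simp_rw [lintegral_sub_right_eq_self h]
    _ = ENNReal.ofReal (2 * R) * ∫⁻ x, h x ∂(muSpace Ω) := by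
        rw [lintegral_const, mul_comm]
        congr 1
        · simp
        · refine (setLIntegral_eq_of_support_subset ?_).symm
          intro x hx
          by_contra hxΩ
          apply hx
          simp [h, hφ.gradient_eq_zero hxΩ, hL]

/-- As `‖G‖ ≤ L`, the excess of `‖∇φₙ‖` over `L` is at most `‖∇φₙ - G‖`. Hence the integrated excess
of `|v|` over `2RL` is controlled by `L¹` distances that tend to `0`. -/
theorem HasH10Gradient.abs_le (hN : 1 ≤ N) {v : Space N → ℝ} {G : Space N → Space N}
    (hv : HasH10Gradient Ω v G) {R : ℝ} (hR : 0 ≤ R) (hΩ : MeasurableSet Ω)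
    (hΩR : Ω ⊆ Metric.ball 0 R) {L : ℝ} (hL : 0 ≤ L) (hG : ∀ᵐ x ∂(muSpace Ω), ‖G x‖ ≤ L) :
    ∀ᵐ x ∂(muSpace Ω), |v x| ≤ 2 * R * L := by
  have hfin : IsFiniteMeasure (muSpace Ω) :=
    isFiniteMeasure_muSpace (Metric.isBounded_ball.subset hΩR)
  obtain ⟨φ, hφ, hφv, hφG⟩ := hv.approx
  have toL1 : ∀ {E : Type} [NormedAddCommGroup E] (F : ℕ → Space N → E)
      (_ : ∀ n, AEStronglyMeasurable (F n) (muSpace Ω))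
      (_ : Tendsto (fun n => eLpNorm (F n) 2 (muSpace Ω)) atTop (𝓝 0)),
      Tendsto (fun n => ∫⁻ x, ‖F n x‖ₑ ∂(muSpace Ω)) atTop (𝓝 0) := by
    intro E _ F hF hlim
    set c := (muSpace Ω univ) ^ (1 / (1 : ℝ≥0∞).toReal - 1 / (2 : ℝ≥0∞).toReal)
    have hc : c ≠ ⊤ := ENNReal.rpow_ne_top_of_nonneg (by norm_num) (measure_ne_top _ _)
    have h1 := ENNReal.Tendsto.mul_const (b := c) hlim (Or.inr hc)
    rw [zero_mul] at h1
    refine tendsto_of_tendsto_of_tendsto_of_le_of_le tendsto_const_nhds h1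
      (fun _ => zero_le) fun n => ?_
    simp only
    rw [← eLpNorm_one_eq_lintegral_enorm]
    exact eLpNorm_le_eLpNorm_mul_rpow_measure_univ (by norm_num) (hF n)
  have l1 := toL1 _ (fun n => (((hφ n).memLp 2).sub hv.memLp).1) hφv
  have l2 := toL1 _ (fun n => (((hφ n).memLp_gradient 2).sub hv.memLp_grad).1) hφG
  have l3 := (ENNReal.Tendsto.const_mul (a := ENNReal.ofReal (2 * R)) l2
    (Or.inr ENNReal.ofReal_ne_top)).add l1
  rw [mul_zero, add_zero] at l3
  have hzero : ∫⁻ x, ENNReal.ofReal (|v x| - 2 * R * L) ∂(muSpace Ω) = 0 := by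
    refine le_antisymm (ge_of_tendsto' l3 fun n => ?_) zero_le
    calc ∫⁻ x, ENNReal.ofReal (|v x| - 2 * R * L) ∂(muSpace Ω)
        ≤ ∫⁻ x, (ENNReal.ofReal (|φ n x| - 2 * R * L) + ‖φ n x - v x‖ₑ) ∂(muSpace Ω) := by
          refine lintegral_mono fun x => ?_
          rw [← ofReal_norm]
          refine le_trans (ENNReal.ofReal_le_ofReal ?_) ENNReal.ofReal_add_le
          have : |v x| ≤ |φ n x| + |φ n x - v x| := by
            have := abs_sub (φ n x) (φ n x - v x)
            simpa using this
          rw [Real.norm_eq_abs]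
          linarith
      _ = ∫⁻ x, ENNReal.ofReal (|φ n x| - 2 * R * L) ∂(muSpace Ω) +
            ∫⁻ x, ‖φ n x - v x‖ₑ ∂(muSpace Ω) := by
          refine lintegral_add_left ?_ _
          have := (hφ n).smooth.continuous.measurable
          fun_prop
      _ ≤ _ := by
          refine add_le_add ?_ le_rfl
          refine ((hφ n).lintegral_ofReal_abs_sub_le hN hR hΩ hΩR hL).trans ?_
          gcongr ENNReal.ofReal (2 * R) * ?_
          refine lintegral_mono_ae ?_
          filter_upwards [hG] with x hx
          rw [← ofReal_norm]
          refine ENNReal.ofReal_le_ofReal ?_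
          have : ‖gradient (φ n) x‖ - ‖G x‖ ≤ ‖(gradient (φ n) - G) x‖ := norm_sub_norm_le _ _
          linarith
  rw [lintegral_eq_zero_iff'] at hzero
  · filter_upwards [hzero] with x hx
    have := ENNReal.ofReal_eq_zero.1 hx
    linarith
  · exact ((hv.memLp.1.norm.aemeasurable).sub_const _).ennreal_ofReal

end SupBound

/-! ### The square of a bounded `H₀¹` function as a limit of nonnegative test functions. -/

section Square

/-- `η` is the primitive of `2r χ(r)` with a cutoff `χ`. The integrand has the sign of `r`, so `η ≥
0`, and its compact support makes both `η` and `η'` globally Lipschitz. -/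
theorem exists_smooth_truncated_sq (K : ℝ) :
    ∃ (η : ℝ → ℝ) (A : ℝ≥0), ContDiff ℝ ∞ η ∧ η 0 = 0 ∧ (∀ s, 0 ≤ η s) ∧
      (∀ s, |s| ≤ K → η s = s ^ 2 ∧ deriv η s = 2 * s) ∧
      LipschitzWith A η ∧ LipschitzWith A (deriv η) := by
  -- The radius `|K| + 1` is positive for every real `K`.
  set χ : ContDiffBump (0 : ℝ) := ⟨|K| + 1, |K| + 2, by positivity, by linarith⟩
  set θ : ℝ → ℝ := fun r => 2 * r * χ r
  have hθ : ContDiff ℝ ∞ θ := (contDiff_const.mul contDiff_id).mul χ.contDiff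
  have hθs : HasCompactSupport θ := χ.hasCompactSupport.mul_left
  set η : ℝ → ℝ := fun s => ∫ r in (0 : ℝ)..s, θ r
  have hd : ∀ s, HasDerivAt η (θ s) s := fun s => hθ.continuous.integral_hasStrictDerivAt 0 s
    |>.hasDerivAt
  have hde : deriv η = θ := funext fun s => (hd s).deriv
  obtain ⟨A, hA⟩ := hθ.lipschitzWith_of_hasCompactSupport hθs (by simp)
  obtain ⟨B, hB⟩ := hθs.exists_bound_of_continuous hθ.continuous
  refine ⟨η, max A B.toNNReal, ?_, by simp [η], ?_, ?_, ?_, ?_⟩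
  · rw [contDiff_infty_iff_deriv, hde]
    exact ⟨fun s => (hd s).differentiableAt, hθ⟩
  · intro s
    rcases le_total 0 s with h | h
    · refine intervalIntegral.integral_nonneg h fun r hr => ?_
      exact mul_nonneg (mul_nonneg zero_le_two hr.1) χ.nonneg
    · simp only [η]
      rw [intervalIntegral.integral_symm, ← intervalIntegral.integral_neg]
      refine intervalIntegral.integral_nonneg h fun r hr => ?_
      have : 0 ≤ (2 * -r) * χ r := mul_nonneg (by linarith [hr.2]) χ.nonneg
      simp only [θ]
      linarith
  · intro s hs
    have hone : ∀ r, |r| ≤ |s| → θ r = 2 * r := by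
      intro r hr
      have : χ r = 1 := χ.one_of_mem_closedBall (by
        simp only [Metric.mem_closedBall, dist_zero_right, Real.norm_eq_abs, χ]
        linarith [le_abs_self K])
      simp [θ, this]
    refine ⟨?_, by rw [hde, hone s le_rfl]⟩
    have : η s = ∫ r in (0 : ℝ)..s, 2 * r := by
      refine intervalIntegral.integral_congr fun r hr => hone r ?_
      rcases le_total 0 s with h | h
      · rw [uIcc_of_le h] at hr
        rw [abs_of_nonneg hr.1, abs_of_nonneg h]; exact hr.2
      · rw [uIcc_of_ge h] at hr
        rw [abs_of_nonpos hr.2, abs_of_nonpos h]; linarith [hr.1]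
    rw [this, intervalIntegral.integral_const_mul, integral_id]
    ring
  · refine (lipschitzWith_of_nnnorm_deriv_le (C := B.toNNReal)
      (fun s => (hd s).differentiableAt) fun s => ?_).weaken (le_max_right _ _)
    rw [hde]
    rw [← NNReal.coe_le_coe, coe_nnnorm]
    exact (hB s).trans (Real.le_coe_toNNReal B)
  · rw [hde]
    exact hA.weaken (le_max_left _ _)

/-- The plain squares `φₙ²` need not converge in `L²`, as the `φₙ` are not uniformly bounded.
Composition with the Lipschitz truncated square avoids this and agrees with `v²` in the limit
because `|v| ≤ K`. -/
theorem HasH10Gradient.exists_nonneg_test_tendsto_sq {N : ℕ} {Ω : Set (Space N)}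
    {v : Space N → ℝ} {G : Space N → Space N} (hv : HasH10Gradient Ω v G) {K L : ℝ}
    (hvK : ∀ᵐ x ∂(muSpace Ω), |v x| ≤ K) (hGL : ∀ᵐ x ∂(muSpace Ω), ‖G x‖ ≤ L) :
    ∃ φ : ℕ → Space N → ℝ, (∀ n, IsTest Ω (φ n) ∧ ∀ x, 0 ≤ φ n x) ∧
      Tendsto (fun n => eLpNorm (fun x => φ n x - v x ^ 2) 2 (muSpace Ω)) atTop (𝓝 0) ∧
      Tendsto (fun n => eLpNorm (fun x => gradient (φ n) x - (2 * v x) • G x) 2 (muSpace Ω))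
        atTop (𝓝 0) := by
  obtain ⟨η, A, hη, hη0, hηn, hηK, hA, hA'⟩ := exists_smooth_truncated_sq K
  obtain ⟨φ, hφ, hφv, hφG⟩ := hv.approx
  have hd : Differentiable ℝ η := hη.differentiable (by simp)
  refine ⟨fun n x => η (φ n x), fun n => ⟨(hφ n).comp hη hη0, fun x => hηn _⟩, ?_, ?_⟩
  · have h1 := ENNReal.Tendsto.const_mul (a := ENNReal.ofReal A) hφv
      (Or.inr ENNReal.ofReal_ne_top)
    rw [mul_zero] at h1
    refine tendsto_of_tendsto_of_tendsto_of_le_of_le tendsto_const_nhds h1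
      (fun _ => zero_le) fun n => ?_
    refine eLpNorm_le_mul_eLpNorm_of_ae_le_mul ?_ 2
    filter_upwards [hvK] with x hx
    rw [← (hηK _ hx).1]
    simpa [dist_eq_norm] using hA.dist_le_mul (φ n x) (v x)
  · have h1 := (ENNReal.Tendsto.const_mul (a := ENNReal.ofReal A) hφG
      (Or.inr ENNReal.ofReal_ne_top)).add
      (ENNReal.Tendsto.const_mul (a := ENNReal.ofReal (A * L)) hφv
      (Or.inr ENNReal.ofReal_ne_top))
    rw [mul_zero, mul_zero, add_zero] at h1
    refine tendsto_of_tendsto_of_tendsto_of_le_of_le tendsto_const_nhds h1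
      (fun _ => zero_le) fun n => ?_
    have hη'c : Continuous (deriv η) := hA'.continuous
    have m1 : AEStronglyMeasurable
        (fun x => deriv η (φ n x) • (gradient (φ n) x - G x)) (muSpace Ω) :=
      ((hη'c.comp (hφ n).smooth.continuous).aestronglyMeasurable).smul
        (((hφ n).memLp_gradient 2).sub hv.memLp_grad).1
    have m2 : AEStronglyMeasurable
        (fun x => (deriv η (φ n x) - deriv η (v x)) • G x) (muSpace Ω) :=
      (((hη'c.comp (hφ n).smooth.continuous).aestronglyMeasurable).sub
        (hη'c.comp_aestronglyMeasurable hv.memLp.1)).smul hv.memLp_grad.1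
    -- The error is split so that one term carries `∇φₙ - G` against the bounded `η'`, and the other
    -- carries `φₙ - v`, through the Lipschitz bound on `η'`, against the bounded `G`.
    have hcongr : eLpNorm (fun x => gradient (fun x => η (φ n x)) x - (2 * v x) • G x) 2
        (muSpace Ω) = eLpNorm ((fun x => deriv η (φ n x) • (gradient (φ n) x - G x)) +
          fun x => (deriv η (φ n x) - deriv η (v x)) • G x) 2 (muSpace Ω) := by
      refine eLpNorm_congr_ae ?_
      filter_upwards [hvK] with x hx
      rw [(hφ n).gradient_comp hd, ← (hηK _ hx).2, Pi.add_apply, smul_sub, sub_smul]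
      abel
    refine (le_of_eq hcongr).trans ((eLpNorm_add_le m1 m2 (by norm_num)).trans ?_)
    refine add_le_add (eLpNorm_le_mul_eLpNorm_of_ae_le_mul (Eventually.of_forall fun x => ?_) 2)
      (eLpNorm_le_mul_eLpNorm_of_ae_le_mul ?_ 2)
    · rw [norm_smul]
      gcongr
      exact norm_deriv_le_of_lipschitz hA
    · filter_upwards [hGL] with x hx
      rw [norm_smul, mul_right_comm]
      refine mul_le_mul ?_ hx (norm_nonneg _) (by positivity)
      simpa [dist_eq_norm] using hA'.dist_le_mul (φ n x) (v x)

end Square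

end GradVI

namespace GradVI

/-! ### One-variable distributions: positivity and the du Bois-Reymond lemma. -/

section OneDim

/-- At almost every point `h` is the limit of its averages against shrinking bumps, which are
eventually test functions in `U`. -/
theorem ae_nonneg_of_forall_test {U : Set ℝ} (hU : IsOpen U) {h : ℝ → ℝ}
    (hh : IntegrableOn h U)
    (H : ∀ ψ, IsTest U ψ → (∀ s, 0 ≤ ψ s) → 0 ≤ ∫ s in U, h s * ψ s) :
    ∀ᵐ s ∂(volume.restrict U), 0 ≤ h s := by
  rw [ae_restrict_iff' hU.measurableSet]
  -- The ratio of the two radii is fixed at `2`, the uniform bound that the differentiation theorem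
  -- for convolutions requires.
  set ρ : ℕ → ContDiffBump (0 : ℝ) := fun n =>
    ⟨1 / (n + 1), 2 * (1 / (n + 1)), by positivity,
      by have : (0 : ℝ) < 1 / (n + 1) := by positivity
         linarith⟩
  have hρ : Tendsto (fun n => (ρ n).rOut) atTop (𝓝 0) := by
    have := (tendsto_one_div_add_atTop_nhds_zero_nat (𝕜 := ℝ)).const_mul 2
    rw [mul_zero] at this
    exact this
  have hg : LocallyIntegrable (U.indicator h) :=
    (hh.integrable_indicator hU.measurableSet).locallyIntegrable
  have := ContDiffBump.ae_convolution_tendsto_right_of_locallyIntegrable (μ := volume) (K := 2)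
    hρ (Eventually.of_forall fun n => le_rfl) hg
  filter_upwards [this] with x hx hxU
  rw [indicator_of_mem hxU] at hx
  obtain ⟨ε, hε, hball⟩ := Metric.isOpen_iff.1 hU x hxU
  refine ge_of_tendsto hx ?_
  filter_upwards [hρ.eventually (gt_mem_nhds hε)] with n hn
  have hsub : Function.support (fun t => (ρ n).normed volume (x - t)) ⊆
      Metric.closedBall x (ρ n).rOut := by
    intro t ht
    have h1 : x - t ∈ Function.support ((ρ n).normed volume) := ht
    rw [ContDiffBump.support_normed_eq, mem_ball_zero_iff] at h1
    rw [Metric.mem_closedBall, dist_comm, dist_eq_norm]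
    exact h1.le
  have htest : IsTest U (fun t => (ρ n).normed volume (x - t)) :=
    { smooth := (ρ n).contDiff_normed.comp (contDiff_const.sub contDiff_id)
      compact_support := HasCompactSupport.of_support_subset_isCompact
        (isCompact_closedBall _ _) hsub
      support_subset := (closure_minimal hsub Metric.isClosed_closedBall).trans
        ((Metric.closedBall_subset_ball hn).trans hball) }
  have := H _ htest fun s => (ρ n).nonneg_normed _
  rw [convolution_lsmul_swap]
  refine this.trans (le_of_eq ?_)
  rw [← integral_indicator hU.measurableSet]
  congr 1; ext t
  by_cases ht : t ∈ U
  · simp [ht, mul_comm]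
  · simp [ht]

/-- `H = W - F`, with `F` the primitive of `Z`, annihilates derivatives of test functions. Any `ψ`
minus the right multiple of a fixed bump of mass one has zero mean, hence is such a derivative, so
`H` is constant. -/
theorem eq_add_integral_of_weakDeriv {T : ℝ} (hT : 0 < T) {W Z : ℝ → ℝ}
    (hW : ContinuousOn W (Icc 0 T)) (hZ : IntegrableOn Z (Ioo 0 T))
    (h : ∀ ψ, IsTest (Ioo 0 T) ψ →
      ∫ t in Ioo 0 T, W t * deriv ψ t = -∫ t in Ioo 0 T, Z t * ψ t) :
    ∀ t ∈ Icc 0 T, W t = W 0 + ∫ s in (0 : ℝ)..t, Z s := by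
  have hZi : IntervalIntegrable Z volume 0 T := by
    rwa [intervalIntegrable_iff_integrableOn_Ioo_of_le hT.le]
  set F : ℝ → ℝ := fun t => ∫ s in (0 : ℝ)..t, Z s
  have hFac : AbsolutelyContinuousOnInterval F 0 T :=
    hZi.absolutelyContinuousOnInterval_intervalIntegral left_mem_uIcc
  have hFc : ContinuousOn F (Icc 0 T) := by
    have := hFac.continuousOn
    rwa [uIcc_of_le hT.le] at this
  have hIoo : ∀ f : ℝ → ℝ, ∫ t in (0 : ℝ)..T, f t = ∫ t in Ioo 0 T, f t := fun f => by
    rw [intervalIntegral.integral_of_le hT.le, integral_Ioc_eq_integral_Ioo]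
  have hFψ : ∀ ψ, IsTest (Ioo 0 T) ψ →
      ∫ t in Ioo 0 T, F t * deriv ψ t = -∫ t in Ioo 0 T, Z t * ψ t := by
    intro ψ hψ
    have hψac : AbsolutelyContinuousOnInterval ψ 0 T :=
      (hψ.smooth.of_le (by simp)).contDiffOn.absolutelyContinuousOnInterval
    have := hFac.integral_mul_deriv_eq_deriv_mul hψac
    rw [hψ.eq_zero (by simp : (0 : ℝ) ∉ Ioo 0 T), hψ.eq_zero (by simp : T ∉ Ioo 0 T)] at this
    simp only [mul_zero, sub_zero, zero_sub] at this
    rw [← hIoo, this, ← hIoo]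
    congr 1
    refine intervalIntegral.integral_congr_ae ?_
    filter_upwards [hZi.ae_hasDerivAt_integral] with x hx hxI
    rw [(hx (uIoc_subset_uIcc hxI) 0 left_mem_uIcc).deriv]
  set H : ℝ → ℝ := fun t => W t - F t
  have hHc : ContinuousOn H (Icc 0 T) := hW.sub hFc
  have hint : ∀ {P Q : ℝ → ℝ}, ContinuousOn P (Icc 0 T) → Continuous Q →
      IntegrableOn (fun t => P t * Q t) (Ioo 0 T) := fun hP hQ =>
    ((hP.mul hQ.continuousOn).integrableOn_Icc).mono_set Ioo_subset_Icc_self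
  have hHψ : ∀ ψ, IsTest (Ioo 0 T) ψ → ∫ t in Ioo 0 T, H t * deriv ψ t = 0 := by
    intro ψ hψ
    have hc : Continuous (deriv ψ) := hψ.smooth.continuous_deriv (by simp)
    simp only [H, sub_mul]
    rw [integral_sub (hint hW hc) (hint hFc hc), h ψ hψ, hFψ ψ hψ, sub_self]
  set ρ : ContDiffBump (T / 2) := ⟨T / 8, T / 4, by positivity, by linarith⟩
  set η : ℝ → ℝ := ρ.normed volume
  have hη : IsTest (Ioo 0 T) η :=
    { smooth := ρ.contDiff_normed
      compact_support := ρ.hasCompactSupport_normed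
      support_subset := by
        rw [ContDiffBump.tsupport_normed_eq]
        intro x hx
        rw [Metric.mem_closedBall, Real.dist_eq, abs_le] at hx
        simp only [ρ] at hx
        constructor <;> linarith [hx.1, hx.2] }
  have hη1 : ∫ t in Ioo 0 T, η t = 1 := by
    rw [setIntegral_eq_integral_of_forall_compl_eq_zero fun x hx => hη.eq_zero hx]
    exact ρ.integral_normed
  set k : ℝ := ∫ t in Ioo 0 T, H t * η t
  have hzero : ∀ᵐ t ∂(volume : Measure ℝ), t ∈ Ioo 0 T → H t - k = 0 := by
    refine isOpen_Ioo.ae_eq_zero_of_integral_contDiff_smul_eq_zero ?_ ?_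
    · exact ((hHc.sub continuousOn_const).mono Ioo_subset_Icc_self).locallyIntegrableOn
        measurableSet_Ioo
    · intro ψ hψ1 hψ2 hψ3
      have hψ : IsTest (Ioo 0 T) ψ := ⟨hψ1, hψ2, hψ3⟩
      set c : ℝ := ∫ t in Ioo 0 T, ψ t
      set q : ℝ → ℝ := fun t => ψ t - c * η t
      have hq : IsTest (Ioo 0 T) q := hψ.sub (hη.const_mul c)
      -- A margin `δ` from both endpoints is what keeps the support of the primitive `θ` compact
      -- inside `(0, T)`: `θ` vanishes before `δ` trivially and after `T - δ` by zero mean.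
      obtain ⟨δ, hδ, hδT⟩ :=
        hq.compact_support.isCompact.exists_cthickening_subset_open isOpen_Ioo hq.support_subset
      have hqδ : ∀ t, t ∉ Icc δ (T - δ) → q t = 0 := by
        intro t ht
        by_contra hne
        have hts : t ∈ tsupport q := subset_tsupport _ hne
        have h1 := hδT (Metric.mem_cthickening_of_dist_le (t - δ) t δ _ hts
          (by simp [abs_of_pos hδ]))
        have h2 := hδT (Metric.mem_cthickening_of_dist_le (t + δ) t δ _ hts
          (by simp [abs_of_pos hδ]))
        exact ht ⟨by linarith [h1.1], by linarith [h2.2]⟩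
      have hqc : Continuous q := hq.smooth.continuous
      set θ : ℝ → ℝ := fun t => ∫ s in (0 : ℝ)..t, q s
      have hd : ∀ s, HasDerivAt θ (q s) s :=
        fun s => (hqc.integral_hasStrictDerivAt 0 s).hasDerivAt
      have hde : deriv θ = q := funext fun s => (hd s).deriv
      have hqT : ∫ s in (0 : ℝ)..T, q s = 0 := by
        rw [hIoo]
        simp only [q]
        rw [integral_sub, integral_const_mul, hη1, mul_one, sub_self]
        · exact (hψ1.continuous.integrableOn_Icc).mono_set Ioo_subset_Icc_self
        · exact ((continuous_const.mul hη.smooth.continuous).integrableOn_Icc).mono_set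
            Ioo_subset_Icc_self
      have hθs : Function.support θ ⊆ Icc δ (T - δ) := by
        intro t ht
        by_contra hn
        apply ht
        rcases not_and_or.1 hn with h' | h'
        · push Not at h'
          refine (intervalIntegral.integral_congr (g := fun _ => 0) fun s hs => ?_).trans (by simp)
          refine hqδ s fun hs' => ?_
          have : s ≤ max 0 t := hs.2
          rcases le_max_iff.1 this with hr | hr <;> linarith [hs'.1]
        · push Not at h'
          have h0 : ∫ s in t..T, q s = 0 := by
            refine (intervalIntegral.integral_congr (g := fun _ => 0) fun s hs => ?_).trans
              (by simp)
            refine hqδ s fun hs' => ?_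
            have : min t T ≤ s := hs.1
            rcases min_le_iff.1 this with hr | hr <;> linarith [hs'.2]
          have := intervalIntegral.integral_add_adjacent_intervals
            (hqc.intervalIntegrable 0 t) (hqc.intervalIntegrable (μ := volume) t T)
          rw [h0, hqT, add_zero] at this
          exact this
      have hθ : IsTest (Ioo 0 T) θ :=
        { smooth := by
            rw [contDiff_infty_iff_deriv, hde]
            exact ⟨fun s => (hd s).differentiableAt, hq.smooth⟩
          compact_support := HasCompactSupport.of_support_subset_isCompact isCompact_Icc hθs
          support_subset := (closure_minimal hθs isClosed_Icc).trans
            fun t ht => ⟨by linarith [ht.1], by linarith [ht.2]⟩ }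
      have h0 := hHψ θ hθ
      rw [hde] at h0
      have h1 : ∫ t in Ioo 0 T, H t * q t = (∫ t in Ioo 0 T, H t * ψ t) - c * k := by
        have : ∀ t, H t * q t = H t * ψ t - c * (H t * η t) := fun t => by simp only [q]; ring
        simp only [this]
        rw [integral_sub (hint hHc hψ1.continuous)
          ((hint hHc hη.smooth.continuous).const_mul c), integral_const_mul]
      have h2 : ∫ t, ψ t • (H t - k) = (∫ t in Ioo 0 T, H t * ψ t) - c * k := by
        rw [← setIntegral_eq_integral_of_forall_compl_eq_zero (s := Ioo 0 T)
          fun x hx => by rw [hψ.eq_zero hx, zero_smul]]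
        have : ∀ t, ψ t • (H t - k) = H t * ψ t - ψ t * k := fun t => by
          rw [smul_eq_mul]; ring
        simp only [this]
        rw [integral_sub (hint hHc hψ1.continuous), integral_mul_const]
        exact ((hψ1.continuous.mul continuous_const).integrableOn_Icc).mono_set
          Ioo_subset_Icc_self
      rw [h2, ← h1, h0]
  -- Continuity extends the almost everywhere identity to every time, including the endpoints `0`
  -- and `T`.
  have hEq : EqOn H (fun _ => k) (Icc 0 T) := by
    refine Measure.eqOn_Icc_of_ae_eq volume hT.ne ?_ hHc continuousOn_const
    rw [restrict_Ioo_eq_restrict_Icc.symm, EventuallyEq, ae_restrict_iff' measurableSet_Ioo]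
    filter_upwards [hzero] with t ht htI
    linarith [ht htI]
  intro t ht
  have h1 := hEq ht
  have h2 := hEq (left_mem_Icc.2 hT.le)
  have h3 : F 0 = 0 := by simp [F]
  simp only [H] at h1 h2
  change W t = W 0 + F t
  linarith

end OneDim

/-! ### Weak time derivatives on the cylinder and the chain rule for `u²`. -/

section Cylinder

variable {N : ℕ} {Ω : Set (Space N)} {T : ℝ}

theorem IsTest.tensor {φ : Space N → ℝ} {ψ : ℝ → ℝ} (hφ : IsTest Ω φ) (hψ : IsTest (Ioo 0 T) ψ) :
    IsTest (cyl Ω T) (fun z => φ z.1 * ψ z.2) := by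
  have hsub : Function.support (fun z : Space N × ℝ => φ z.1 * ψ z.2) ⊆
      tsupport φ ×ˢ tsupport ψ := by
    intro z hz
    have := mul_ne_zero_iff.1 hz
    exact ⟨subset_tsupport _ this.1, subset_tsupport _ this.2⟩
  exact
    { smooth := (hφ.smooth.comp contDiff_fst).mul (hψ.smooth.comp contDiff_snd)
      compact_support := HasCompactSupport.of_support_subset_isCompact
        (hφ.compact_support.isCompact.prod hψ.compact_support.isCompact) hsub
      support_subset := (closure_minimal hsub
        ((isClosed_tsupport _).prod (isClosed_tsupport _))).trans
        (prod_mono hφ.support_subset hψ.support_subset) }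

variable {u ut : Space N × ℝ → ℝ}

theorem exists_bound_of_continuousOn_closure (hΩb : Bornology.IsBounded Ω)
    (hu : ContinuousOn u (closure Ω ×ˢ Icc 0 T)) :
    ∃ B, ∀ z ∈ closure Ω ×ˢ Icc 0 T, ‖u z‖ ≤ B :=
  (hΩb.isCompact_closure.prod isCompact_Icc).exists_bound_of_continuousOn hu

theorem continuousOn_time (hu : ContinuousOn u (closure Ω ×ˢ Icc 0 T)) {x : Space N}
    (hx : x ∈ Ω) : ContinuousOn (fun t => u (x, t)) (Icc 0 T) :=
  hu.comp (by fun_prop) fun _ ht => ⟨subset_closure hx, ht⟩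

theorem continuousOn_space (hu : ContinuousOn u (closure Ω ×ˢ Icc 0 T)) {t : ℝ}
    (ht : t ∈ Icc 0 T) : ContinuousOn (fun x => u (x, t)) Ω :=
  hu.comp (by fun_prop) fun _ hx => ⟨subset_closure hx, ht⟩

theorem aestronglyMeasurable_slice (hΩ : MeasurableSet Ω)
    (hu : ContinuousOn u (closure Ω ×ˢ Icc 0 T)) {t : ℝ} (ht : t ∈ Icc 0 T) :
    AEStronglyMeasurable (fun x => u (x, t)) (muSpace Ω) :=
  (continuousOn_space hu ht).aestronglyMeasurable hΩ

theorem cyl_subset {τ : ℝ} (hτ : τ ≤ T) : cyl Ω τ ⊆ closure Ω ×ˢ Icc 0 T :=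
  prod_mono subset_closure fun _ ht => ⟨ht.1.le, ht.2.le.trans hτ⟩

theorem measurableSet_cyl (hΩ : MeasurableSet Ω) (T : ℝ) : MeasurableSet (cyl Ω T) :=
  hΩ.prod measurableSet_Ioo

theorem aestronglyMeasurable_cyl (hΩ : MeasurableSet Ω)
    (hu : ContinuousOn u (closure Ω ×ˢ Icc 0 T)) :
    AEStronglyMeasurable u (muCyl Ω T) :=
  (hu.mono (cyl_subset le_rfl)).aestronglyMeasurable (measurableSet_cyl hΩ T)

theorem muCyl_mono {τ : ℝ} (hτ : τ ≤ T) : muCyl Ω τ ≤ muCyl Ω T :=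
  Measure.restrict_mono (prod_mono le_rfl (Ioo_subset_Ioo_right hτ)) le_rfl

theorem isFiniteMeasure_muCyl (hΩb : Bornology.IsBounded Ω) (T : ℝ) :
    IsFiniteMeasure (muCyl Ω T) := by
  have := isFiniteMeasure_muSpace hΩb
  rw [muCyl_eq_prod]
  infer_instance

/-- Testing with products `φ(x) ψ(t)` reduces the claim to one-variable identities for the moments
`∫ u(·, t) φ`. Letting `φ` vary then gives the formula for almost every `x`, at each fixed `t`. -/
theorem ae_eq_add_integral (hΩ : IsOpen Ω) (hΩb : Bornology.IsBounded Ω) (hT : 0 < T)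
    (hu : ContinuousOn u (closure Ω ×ˢ Icc 0 T)) (hut : Integrable ut (muCyl Ω T))
    (hw : HasWeakTimeDeriv Ω T u ut) :
    ∀ᵐ x ∂(muSpace Ω), IntervalIntegrable (fun t => ut (x, t)) volume 0 T ∧
      ∀ t ∈ Icc 0 T, u (x, t) = u (x, 0) + ∫ s in (0 : ℝ)..t, ut (x, s) := by
  have hfs := isFiniteMeasure_muSpace hΩb
  have hfc := isFiniteMeasure_muCyl hΩb T
  obtain ⟨B, hB⟩ := exists_bound_of_continuousOn_closure hΩb hu
  have hum := aestronglyMeasurable_cyl hΩ.measurableSet hu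
  have hsl : ∀ {t}, t ∈ Icc 0 T → ∀ x ∈ Ω, ‖u (x, t)‖ ≤ B := fun ht x hx =>
    hB _ ⟨subset_closure hx, ht⟩
  have hui : Integrable u (muCyl Ω T) := by
    refine Integrable.of_bound hum B ?_
    filter_upwards [self_mem_ae_restrict (measurableSet_cyl hΩ.measurableSet T)] with z hz
    exact hB z (cyl_subset le_rfl hz)
  have hut' := hut
  rw [muCyl_eq_prod] at hut'
  have hii : ∀ᵐ x ∂(muSpace Ω), IntervalIntegrable (fun t => ut (x, t)) volume 0 T := by
    filter_upwards [hut'.prod_right_ae] with x hx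
    rw [intervalIntegrable_iff_integrableOn_Ioo_of_le hT.le]
    exact hx
  have hfix : ∀ t ∈ Icc 0 T, ∀ᵐ x ∂(muSpace Ω),
      u (x, t) = u (x, 0) + ∫ s in (0 : ℝ)..t, ut (x, s) := by
    intro t ht
    have hIoo : ∀ f : ℝ → ℝ, ∫ s in (0 : ℝ)..t, f s = ∫ s, f s ∂(muTime t) := fun f => by
      rw [intervalIntegral.integral_of_le ht.1, integral_Ioc_eq_integral_Ioo, muTime]
    have hutt : Integrable ut ((muSpace Ω).prod (muTime t)) := by
      rw [← muCyl_eq_prod]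
      exact hut.mono_measure (muCyl_mono ht.2)
    have hslice : ∀ {t}, t ∈ Icc 0 T → Integrable (fun x => u (x, t)) (muSpace Ω) := by
      intro t ht
      refine Integrable.of_bound (aestronglyMeasurable_slice hΩ.measurableSet hu ht) B ?_
      filter_upwards [self_mem_ae_restrict hΩ.measurableSet] with x hx using hsl ht x hx
    have h0 : (0 : ℝ) ∈ Icc 0 T := left_mem_Icc.2 hT.le
    have hdiff : Integrable
        (fun x => u (x, t) - u (x, 0) - ∫ s, ut (x, s) ∂(muTime t)) (muSpace Ω) :=
      ((hslice ht).sub (hslice h0)).sub hutt.integral_prod_left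
    have key : ∀ᵐ x ∂(volume : Measure (Space N)), x ∈ Ω →
        u (x, t) - u (x, 0) - ∫ s, ut (x, s) ∂(muTime t) = 0 := by
      refine hΩ.ae_eq_zero_of_integral_contDiff_smul_eq_zero ?_ ?_
      · exact IntegrableOn.locallyIntegrableOn hdiff
      · intro φ hφ1 hφ2 hφ3
        have hφ : IsTest Ω φ := ⟨hφ1, hφ2, hφ3⟩
        obtain ⟨A, hA⟩ := hφ2.exists_bound_of_continuous hφ1.continuous
        have hφm : AEStronglyMeasurable φ (muSpace Ω) := hφ1.continuous.aestronglyMeasurable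
        have hφm' : ∀ μ : Measure (Space N × ℝ), AEStronglyMeasurable (fun z => φ z.1) μ :=
          fun μ => (hφ1.continuous.comp continuous_fst).aestronglyMeasurable
        have hbφ : ∀ {μ : Measure (Space N × ℝ)} {f : Space N × ℝ → ℝ}, Integrable f μ →
            Integrable (fun z => f z * φ z.1) μ := fun hf =>
          hf.mul_bdd (c := A) (hφm' _) (Eventually.of_forall fun z => hA z.1)
        set W : ℝ → ℝ := fun t => ∫ x, u (x, t) * φ x ∂(muSpace Ω)
        set Z : ℝ → ℝ := fun t => ∫ x, ut (x, t) * φ x ∂(muSpace Ω)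
        have hW : ContinuousOn W (Icc 0 T) := by
          refine continuousOn_of_dominated (bound := fun _ => B * A) ?_ ?_
            (integrable_const _) ?_
          · exact fun s hs => (aestronglyMeasurable_slice hΩ.measurableSet hu hs).mul hφm
          · intro s hs
            filter_upwards [self_mem_ae_restrict hΩ.measurableSet] with x hx
            rw [norm_mul]
            exact mul_le_mul (hsl hs x hx) (hA x) (norm_nonneg _)
              ((norm_nonneg _).trans (hsl hs x hx))
          · filter_upwards [self_mem_ae_restrict hΩ.measurableSet] with x hx
            exact (continuousOn_time hu hx).mul continuousOn_const
        have hZ : IntegrableOn Z (Ioo 0 T) := (hbφ hut').integral_prod_right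
        have hweak : ∀ ψ, IsTest (Ioo 0 T) ψ →
            ∫ t in Ioo 0 T, W t * deriv ψ t = -∫ t in Ioo 0 T, Z t * ψ t := by
          intro ψ hψ
          have := hw _ (hφ.tensor hψ)
          obtain ⟨A1, hA1⟩ := hψ.compact_support.exists_bound_of_continuous hψ.smooth.continuous
          have hdc : Continuous (deriv ψ) := hψ.smooth.continuous_deriv (by simp)
          obtain ⟨A2, hA2⟩ := hψ.compact_support.deriv.exists_bound_of_continuous hdc
          have hd : ∀ z : Space N × ℝ, deriv (fun t => φ z.1 * ψ t) z.2 =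
              φ z.1 * deriv ψ z.2 := fun z =>
            deriv_const_mul _ (hψ.smooth.differentiable (by simp) _)
          simp only [hd] at this
          rw [muCyl_eq_prod] at hui
          have i1 : Integrable (fun z => u z * φ z.1 * deriv ψ z.2)
              ((muSpace Ω).prod (muTime T)) :=
            (hbφ hui).mul_bdd (c := A2) (hdc.comp continuous_snd).aestronglyMeasurable
              (Eventually.of_forall fun z => hA2 z.2)
          have i2 : Integrable (fun z => ut z * φ z.1 * ψ z.2)
              ((muSpace Ω).prod (muTime T)) :=
            (hbφ hut').mul_bdd (c := A1)
              (hψ.smooth.continuous.comp continuous_snd).aestronglyMeasurable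
              (Eventually.of_forall fun z => hA1 z.2)
          simp only [← mul_assoc] at this
          rw [muCyl_eq_prod, integral_prod_symm _ i1, integral_prod_symm _ i2] at this
          simp only [integral_mul_const] at this
          exact this
        have hWt := eq_add_integral_of_weakDeriv hT hW hZ hweak t ht
        rw [hIoo] at hWt
        have hswap : ∫ s, Z s ∂(muTime t) =
            ∫ x, (∫ s, ut (x, s) ∂(muTime t)) * φ x ∂(muSpace Ω) := by
          simp only [Z, ← integral_mul_const]
          rw [← integral_prod_symm _ (hbφ hutt), integral_prod _ (hbφ hutt)]
        rw [hswap] at hWt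
        have e1 : ∫ x, φ x • (u (x, t) - u (x, 0) - ∫ s, ut (x, s) ∂(muTime t)) =
            ∫ x, φ x • (u (x, t) - u (x, 0) - ∫ s, ut (x, s) ∂(muTime t)) ∂(muSpace Ω) := by
          refine (setIntegral_eq_integral_of_forall_compl_eq_zero fun x hx => ?_).symm
          rw [hφ.eq_zero hx, zero_smul]
        have e2 : ∀ x, φ x • (u (x, t) - u (x, 0) - ∫ s, ut (x, s) ∂(muTime t)) =
            u (x, t) * φ x - u (x, 0) * φ x - (∫ s, ut (x, s) ∂(muTime t)) * φ x := fun x => by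
          rw [smul_eq_mul]; ring
        have hbs : ∀ {f : Space N → ℝ}, Integrable f (muSpace Ω) →
            Integrable (fun x => f x * φ x) (muSpace Ω) := fun hf =>
          hf.mul_bdd (c := A) hφm (Eventually.of_forall fun z => hA z)
        rw [e1]
        simp only [e2]
        have hd1 : Integrable (fun x => u (x, t) * φ x - u (x, 0) * φ x) (muSpace Ω) :=
          (hbs (hslice ht)).sub (hbs (hslice h0))
        rw [integral_sub hd1 (hbs hutt.integral_prod_left),
          integral_sub (hbs (hslice ht)) (hbs (hslice h0))]
        simp only [W] at hWt
        rw [hWt]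
        ring
    rw [muSpace, ae_restrict_iff' hΩ.measurableSet]
    filter_upwards [key] with x hx hxΩ
    rw [hIoo]
    linarith [hx hxΩ]
  -- The exceptional null set depends on `t`. A countable dense set of times gives a common null
  -- set, and continuity in time covers the remaining `t`.
  obtain ⟨D, hDs, hDc, hDd⟩ := (TopologicalSpace.IsSeparable.of_separableSpace
    (Icc (0 : ℝ) T)).exists_countable_dense_subset
  have hall : ∀ᵐ x ∂(muSpace Ω), ∀ t ∈ D,
      u (x, t) = u (x, 0) + ∫ s in (0 : ℝ)..t, ut (x, s) :=
    (ae_ball_iff hDc).2 fun t ht => hfix t (hDs ht)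
  filter_upwards [hii, hall, self_mem_ae_restrict hΩ.measurableSet] with x hx1 hx2 hx3
  refine ⟨hx1, ?_⟩
  have hFc := (hx1.absolutelyContinuousOnInterval_intervalIntegral
    (c := 0) left_mem_uIcc).continuousOn
  rw [uIcc_of_le hT.le] at hFc
  exact EqOn.of_subset_closure (fun t ht => hx2 t ht) (continuousOn_time hu hx3)
    (continuousOn_const.add hFc) hDs hDd

/-- On almost every line `{x} × [0, τ]` the function is absolutely continuous, so integration by
parts of it against itself is legitimate; Fubini sums over `x`. -/
theorem integral_sq_sub_integral_sq (hΩ : IsOpen Ω) (hΩb : Bornology.IsBounded Ω) (hT : 0 < T)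
    (hu : ContinuousOn u (closure Ω ×ˢ Icc 0 T)) (hut : Integrable ut (muCyl Ω T))
    (hw : HasWeakTimeDeriv Ω T u ut) {τ : ℝ} (hτ : τ ∈ Icc 0 T) :
    ∫ x, u (x, τ) ^ 2 ∂(muSpace Ω) - ∫ x, u (x, 0) ^ 2 ∂(muSpace Ω) =
      2 * ∫ z, ut z * u z ∂(muCyl Ω τ) := by
  have hfs := isFiniteMeasure_muSpace hΩb
  obtain ⟨B, hB⟩ := exists_bound_of_continuousOn_closure hΩb hu
  have hsq : ∀ t ∈ Icc 0 T, Integrable (fun x => u (x, t) ^ 2) (muSpace Ω) := by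
    intro t ht
    refine Integrable.of_bound
      ((aestronglyMeasurable_slice hΩ.measurableSet hu ht).pow 2) (B ^ 2) ?_
    filter_upwards [self_mem_ae_restrict hΩ.measurableSet] with x hx
    rw [norm_pow]
    exact pow_le_pow_left₀ (norm_nonneg _) (hB _ ⟨subset_closure hx, ht⟩) 2
  have hint : Integrable (fun z => ut z * u z) ((muSpace Ω).prod (muTime τ)) := by
    rw [← muCyl_eq_prod]
    refine Integrable.mono_measure ?_ (muCyl_mono hτ.2)
    refine hut.mul_bdd (c := B) (aestronglyMeasurable_cyl hΩ.measurableSet hu) ?_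
    filter_upwards [self_mem_ae_restrict (measurableSet_cyl hΩ.measurableSet T)] with z hz
    exact hB z (cyl_subset le_rfl hz)
  rw [← integral_sub (hsq τ hτ) (hsq 0 (left_mem_Icc.2 hT.le)), muCyl_eq_prod,
    integral_prod _ hint, ← integral_const_mul]
  refine integral_congr_ae ?_
  filter_upwards [ae_eq_add_integral hΩ hΩb hT hu hut hw] with x hx
  obtain ⟨hx1, hx2⟩ := hx
  have hsub : uIcc 0 τ ⊆ uIcc 0 T := by
    rw [uIcc_of_le hτ.1, uIcc_of_le hT.le]; exact Icc_subset_Icc_right hτ.2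
  have hx1' : IntervalIntegrable (fun t => ut (x, t)) volume 0 τ := hx1.mono_set hsub
  set F : ℝ → ℝ := fun t => u (x, 0) + ∫ s in (0 : ℝ)..t, ut (x, s)
  have hconst : AbsolutelyContinuousOnInterval (fun _ : ℝ => u (x, 0)) 0 τ :=
    (LipschitzWith.const (u (x, 0))).lipschitzOnWith.absolutelyContinuousOnInterval
  have hF : AbsolutelyContinuousOnInterval F 0 τ :=
    hconst.add (hx1'.absolutelyContinuousOnInterval_intervalIntegral left_mem_uIcc)
  have hIBP := hF.integral_deriv_mul_eq_sub hF
  have hcongr : ∫ t in (0 : ℝ)..τ, (deriv F t * F t + F t * deriv F t) =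
      ∫ t in (0 : ℝ)..τ, 2 * (ut (x, t) * u (x, t)) := by
    refine intervalIntegral.integral_congr_ae ?_
    filter_upwards [hx1'.ae_hasDerivAt_integral] with t ht htI
    have hd : deriv F t = ut (x, t) :=
      ((ht (uIoc_subset_uIcc htI) 0 left_mem_uIcc).const_add _).deriv
    rw [uIoc_of_le hτ.1] at htI
    have hFt : F t = u (x, t) := (hx2 t ⟨htI.1.le, htI.2.trans hτ.2⟩).symm
    rw [hd, hFt]; ring
  rw [hcongr] at hIBP
  have hF0 : F 0 = u (x, 0) := by simp [F]
  have hFτ : F τ = u (x, τ) := (hx2 τ hτ).symm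
  rw [hF0, hFτ, intervalIntegral.integral_of_le hτ.1, integral_Ioc_eq_integral_Ioo,
    integral_const_mul] at hIBP
  change u (x, τ) ^ 2 - u (x, 0) ^ 2 = 2 * ∫ t in Ioo 0 τ, ut (x, t) * u (x, t)
  rw [hIBP]; ring

end Cylinder

end GradVI

namespace GradVI

/-! ### Time slices and coercivity at almost every time. -/

section Slices

variable {N : ℕ} {Ω : Set (Space N)} {T : ℝ}

theorem memLp_slice_time {E : Type*} [NormedAddCommGroup E] {f : Space N × ℝ → E}
    (hf : MemLp f 2 (muCyl Ω T)) :
    ∀ᵐ t ∂(muTime T), MemLp (fun x => f (x, t)) 2 (muSpace Ω) := by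
  have h1 := (memLp_two_iff_integrable_sq_norm hf.1).1 hf
  have h2 := hf.1
  rw [muCyl_eq_prod] at h1 h2
  filter_upwards [h1.prod_left_ae, h2.prodMk_right] with t ht1 ht2
  exact (memLp_two_iff_integrable_sq_norm ht2).2 ht1

theorem muTime_mono {τ : ℝ} (hτ : τ ≤ T) : muTime τ ≤ muTime T :=
  Measure.restrict_mono (Ioo_subset_Ioo_right hτ) le_rfl

end Slices

section Coercive

variable {N : ℕ} {Ω : Set (Space N)} {T l : ℝ} {b : Space N × ℝ → Space N}
  {c : Space N × ℝ → ℝ}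

/-- Products `φ(x) ψ(t)` with `ψ ≥ 0` turn the space-time condition into positivity of a function of
`t` against every nonnegative `ψ`. -/
theorem WeaklyCoercive.ae_nonneg_test (hΩb : Bornology.IsBounded Ω)
    (hb : MemLp b 2 (muCyl Ω T)) (hc : MemLp c 2 (muCyl Ω T)) (h : WeaklyCoercive Ω T l b c)
    {φ : Space N → ℝ} (hφ : IsTest Ω φ) (hφ0 : ∀ x, 0 ≤ φ x) :
    ∀ᵐ t ∂(muTime T), 0 ≤ ∫ x, ((c (x, t) - l) * φ x +
      1 / 2 * inner ℝ (b (x, t)) (gradient φ x)) ∂(muSpace Ω) := by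
  have hfc := isFiniteMeasure_muCyl hΩb T
  have hbi := hb.integrable (by norm_num)
  have hci := hc.integrable (by norm_num)
  obtain ⟨A, hA⟩ := hφ.compact_support.exists_bound_of_continuous hφ.smooth.continuous
  obtain ⟨A', hA'⟩ := hφ.hasCompactSupport_gradient.exists_bound_of_continuous
    hφ.continuous_gradient
  have hφm : AEStronglyMeasurable (fun z : Space N × ℝ => φ z.1) (muCyl Ω T) :=
    (hφ.smooth.continuous.comp continuous_fst).aestronglyMeasurable
  have hgm : AEStronglyMeasurable (fun z : Space N × ℝ => gradient φ z.1) (muCyl Ω T) :=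
    (hφ.continuous_gradient.comp continuous_fst).aestronglyMeasurable
  have i1 : Integrable (fun z => c z * φ z.1) (muCyl Ω T) :=
    hci.mul_bdd (c := A) hφm (Eventually.of_forall fun z => hA z.1)
  have i2 : Integrable (fun z => inner ℝ (b z) (gradient φ z.1)) (muCyl Ω T) := by
    refine (hbi.norm.mul_const A').mono' (hb.1.inner hgm) (Eventually.of_forall fun z => ?_)
    refine (norm_inner_le_norm _ _).trans ?_
    gcongr
    exact hA' z.1
  have i3 : Integrable (fun z : Space N × ℝ => l * φ z.1) (muCyl Ω T) :=
    (Integrable.of_bound hφm A (Eventually.of_forall fun z => hA z.1)).const_mul l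
  have i4 : Integrable (fun z => (c z - l) * φ z.1 + 1 / 2 * inner ℝ (b z) (gradient φ z.1))
      (muCyl Ω T) := by
    refine ((i1.sub i3).add (i2.const_mul (1 / 2))).congr (Eventually.of_forall fun z => ?_)
    simp only [Pi.add_apply, Pi.sub_apply]
    ring
  have i4' := i4
  rw [muCyl_eq_prod] at i4'
  refine ae_nonneg_of_forall_test isOpen_Ioo i4'.integral_prod_right fun ψ hψ hψ0 => ?_
  obtain ⟨B, hB⟩ := hψ.compact_support.exists_bound_of_continuous hψ.smooth.continuous
  have hψm : AEStronglyMeasurable (fun z : Space N × ℝ => ψ z.2) (muCyl Ω T) :=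
    (hψ.smooth.continuous.comp continuous_snd).aestronglyMeasurable
  have hmul : ∀ {f : Space N × ℝ → ℝ}, Integrable f (muCyl Ω T) →
      Integrable (fun z => f z * ψ z.2) (muCyl Ω T) := fun hf =>
    hf.mul_bdd (c := B) hψm (Eventually.of_forall fun z => hB z.2)
  have hco := h _ (hφ.tensor hψ) fun z => mul_nonneg (hφ0 _) (hψ0 _)
  have hgrad : ∀ z : Space N × ℝ, gradient (fun y => φ y * ψ z.2) z.1 =
      ψ z.2 • gradient φ z.1 := by
    intro z
    have := hφ.gradient_comp (η := fun s => s * ψ z.2) (by fun_prop) z.1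
    rw [this]
    congr 1
    simp
  simp only [hgrad, inner_smul_right] at hco
  have e : ∫ t in Ioo 0 T, (∫ x, ((c (x, t) - l) * φ x +
      1 / 2 * inner ℝ (b (x, t)) (gradient φ x)) ∂(muSpace Ω)) * ψ t =
      ∫ z, ((c z - l) * φ z.1 + 1 / 2 * inner ℝ (b z) (gradient φ z.1)) * ψ z.2
        ∂(muCyl Ω T) := by
    have i5 := hmul i4
    rw [muCyl_eq_prod] at i5 ⊢
    rw [integral_prod_symm _ i5]
    simp only [integral_mul_const]
    rfl
  rw [e]
  have e2 : ∀ z : Space N × ℝ,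
      ((c z - l) * φ z.1 + 1 / 2 * inner ℝ (b z) (gradient φ z.1)) * ψ z.2 =
      (c z * (φ z.1 * ψ z.2) + 1 / 2 * (ψ z.2 * inner ℝ (b z) (gradient φ z.1))) -
        l * (φ z.1 * ψ z.2) := fun z => by ring
  simp only [e2]
  rw [integral_sub, integral_const_mul]
  · linarith
  · refine ((hmul i1).add ((hmul i2).const_mul (1 / 2))).congr (Eventually.of_forall fun z => ?_)
    simp only [Pi.add_apply]
    ring
  · refine (hmul i3).congr (Eventually.of_forall fun z => ?_)
    simp only
    ring

/-- The exceptional set of times must not depend on `v`, since `v` will be `w(·, t)²`, which changes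
with `t`. -/
theorem WeaklyCoercive.ae_nonneg (hΩb : Bornology.IsBounded Ω)
    (hb : MemLp b 2 (muCyl Ω T)) (hc : MemLp c 2 (muCyl Ω T)) (h : WeaklyCoercive Ω T l b c) :
    ∀ᵐ t ∂(muTime T), ∀ (v : Space N → ℝ) (G : Space N → Space N),
      MemLp v 2 (muSpace Ω) → MemLp G 2 (muSpace Ω) →
      (∃ φ : ℕ → Space N → ℝ, (∀ n, IsTest Ω (φ n) ∧ ∀ x, 0 ≤ φ n x) ∧
        Tendsto (fun n => eLpNorm (fun x => φ n x - v x) 2 (muSpace Ω)) atTop (𝓝 0) ∧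
        Tendsto (fun n => eLpNorm (fun x => gradient (φ n) x - G x) 2 (muSpace Ω))
          atTop (𝓝 0)) →
      0 ≤ ∫ x, ((c (x, t) - l) * v x + 1 / 2 * inner ℝ (b (x, t)) (G x)) ∂(muSpace Ω) := by
  have hfs := isFiniteMeasure_muSpace hΩb
  have : Fact ((2 : ℝ≥0∞) ≠ ⊤) := ⟨by norm_num⟩
  -- Nonnegative test functions with their gradients form a separable subset of `L² × L²`.
  -- Positivity on a countable dense part passes to the closure, because for fixed `t` the form `Λ`
  -- is continuous.
  set S : Set (Lp ℝ 2 (muSpace Ω) × Lp (Space N) 2 (muSpace Ω)) :=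
    {p | ∃ (φ : Space N → ℝ) (hφ : IsTest Ω φ), (∀ x, 0 ≤ φ x) ∧
      p = ((hφ.memLp 2).toLp φ, (hφ.memLp_gradient 2).toLp (gradient φ))} with hS
  obtain ⟨D, hDS, hDc, hDd⟩ :=
    (TopologicalSpace.IsSeparable.of_separableSpace S).exists_countable_dense_subset
  choose! Φ hΦ hΦ0 hΦe using hDS
  have hall := (ae_ball_iff hDc).2 fun p hp =>
    WeaklyCoercive.ae_nonneg_test hΩb hb hc h (hΦ hp) (hΦ0 hp)
  filter_upwards [hall, memLp_slice_time hb, memLp_slice_time hc] with t ht hbt hct v G hv hG hap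
  have hct' : MemLp (fun x => c (x, t) - l) 2 (muSpace Ω) := hct.sub (memLp_const l)
  set Λ : Lp ℝ 2 (muSpace Ω) × Lp (Space N) 2 (muSpace Ω) → ℝ := fun p =>
    inner ℝ (hct'.toLp _) p.1 + 1 / 2 * inner ℝ (hbt.toLp _) p.2
  have hΛ : ∀ {v : Space N → ℝ} {G : Space N → Space N} (hv : MemLp v 2 (muSpace Ω))
      (hG : MemLp G 2 (muSpace Ω)), Λ (hv.toLp v, hG.toLp G) =
      ∫ x, ((c (x, t) - l) * v x + 1 / 2 * inner ℝ (b (x, t)) (G x)) ∂(muSpace Ω) := by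
    intro v G hv hG
    have j1 : Integrable (fun x => (c (x, t) - l) * v x) (muSpace Ω) :=
      (integrable_inner_of_memLp hct' hv).congr (Eventually.of_forall fun x => by simp [mul_comm])
    have j2 := integrable_inner_of_memLp hbt hG
    rw [integral_add j1 (j2.const_mul _), integral_const_mul]
    simp only [Λ, L2.inner_def]
    congr 1
    · refine integral_congr_ae ?_
      filter_upwards [hct'.coeFn_toLp, hv.coeFn_toLp] with x h1 h2
      rw [h1, h2]
      simp [mul_comm]
    · congr 1
      refine integral_congr_ae ?_
      filter_upwards [hbt.coeFn_toLp, hG.coeFn_toLp] with x h1 h2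
      rw [h1, h2]
  have hcont : Continuous Λ := by fun_prop
  have hclosed : IsClosed {p | 0 ≤ Λ p} := isClosed_le continuous_const hcont
  have hD : D ⊆ {p | 0 ≤ Λ p} := by
    intro p hp
    have := ht p hp
    rw [← hΛ ((hΦ hp).memLp 2) ((hΦ hp).memLp_gradient 2), ← hΦe hp] at this
    exact this
  have hSΛ : closure S ⊆ {p | 0 ≤ Λ p} :=
    (closure_minimal hDd isClosed_closure).trans (closure_minimal hD hclosed)
  obtain ⟨φ, hφ, hφv, hφG⟩ := hap
  have hmem : (hv.toLp v, hG.toLp G) ∈ closure S := by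
    refine mem_closure_of_tendsto (f := fun n =>
      (((hφ n).1.memLp 2).toLp (φ n), ((hφ n).1.memLp_gradient 2).toLp (gradient (φ n))))
      (b := atTop) ?_ (Eventually.of_forall fun n => ⟨φ n, (hφ n).1, (hφ n).2, rfl⟩)
    refine Tendsto.prodMk_nhds ?_ ?_
    · exact (Lp.tendsto_Lp_iff_tendsto_eLpNorm'' _ (fun n => (hφ n).1.memLp 2) _ hv).2 hφv
    · exact (Lp.tendsto_Lp_iff_tendsto_eLpNorm'' _ (fun n => (hφ n).1.memLp_gradient 2) _ hG).2 hφG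
  have : 0 ≤ Λ (hv.toLp v, hG.toLp G) := hSΛ hmem
  rwa [hΛ hv hG] at this

end Coercive

/-! ### Gronwall's inequality in integral form. -/

section Gronwall

/-- The hypothesis says exactly that `exp(-a t) (A + a ∫₀ᵗ y)` has nonpositive derivative. -/
theorem le_mul_exp_of_le_add_integral {T A a : ℝ} {y : ℝ → ℝ} (ha : 0 ≤ a)
    (hy : ContinuousOn y (Icc 0 T))
    (h : ∀ t ∈ Icc 0 T, y t ≤ A + a * ∫ s in (0 : ℝ)..t, y s) :
    ∀ t ∈ Icc 0 T, y t ≤ A * Real.exp (a * t) := by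
  intro t ht
  have hT : 0 ≤ T := ht.1.trans ht.2
  set Y : ℝ → ℝ := fun t => ∫ s in (0 : ℝ)..t, y s
  set q : ℝ → ℝ := fun t => Real.exp (-(a * t)) * (A + a * Y t)
  have hyi : ∀ t ∈ Icc 0 T, IntervalIntegrable y volume 0 t := fun t ht =>
    (hy.mono (by rw [uIcc_of_le ht.1]; exact Icc_subset_Icc_right ht.2)).intervalIntegrable
  have hYc : ContinuousOn Y (Icc 0 T) := by
    have := intervalIntegral.continuousOn_primitive_interval' (hyi T (right_mem_Icc.2 hT))
      left_mem_uIcc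
    rwa [uIcc_of_le hT] at this
  have hYd : ∀ t ∈ Ioo 0 T, HasDerivAt Y (y t) t := by
    intro t ht
    exact intervalIntegral.integral_hasDerivAt_right (hyi t (Ioo_subset_Icc_self ht))
      ((hy.mono Ioo_subset_Icc_self).stronglyMeasurableAtFilter isOpen_Ioo t ht)
      (hy.continuousAt (Icc_mem_nhds ht.1 ht.2))
  have hqd : ∀ t ∈ Ioo 0 T, HasDerivAt q
      (Real.exp (-(a * t)) * (-(a * 1)) * (A + a * Y t) + Real.exp (-(a * t)) * (a * y t)) t := by
    intro t ht
    have h1 : HasDerivAt (fun t => Real.exp (-(a * t))) (Real.exp (-(a * t)) * (-(a * 1))) t :=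
      (((hasDerivAt_id t).const_mul a).neg).exp
    exact h1.mul (((hYd t ht).const_mul a).const_add A)
  have hanti : AntitoneOn q (Icc 0 T) := by
    refine antitoneOn_of_deriv_nonpos (convex_Icc 0 T) ?_ ?_ ?_
    · exact ContinuousOn.mul (by fun_prop) (continuousOn_const.add (continuousOn_const.mul hYc))
    · rw [interior_Icc]
      exact fun t ht => (hqd t ht).differentiableAt.differentiableWithinAt
    · rw [interior_Icc]
      intro t ht
      rw [(hqd t ht).deriv]
      have h1 := h t (Ioo_subset_Icc_self ht)
      have h2 : Real.exp (-(a * t)) * (-(a * 1)) * (A + a * Y t) +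
          Real.exp (-(a * t)) * (a * y t) =
          Real.exp (-(a * t)) * a * (y t - (A + a * Y t)) := by ring
      rw [h2]
      exact mul_nonpos_of_nonneg_of_nonpos (by positivity) (sub_nonpos.2 h1)
  have hq := hanti (left_mem_Icc.2 hT) ht ht.1
  have hq0 : q 0 = A := by simp [q, Y]
  rw [hq0] at hq
  have h3 : A + a * Y t = q t * Real.exp (a * t) := by
    simp only [q]
    rw [mul_right_comm, ← Real.exp_add]
    simp
  calc y t ≤ A + a * Y t := h t ht
    _ = q t * Real.exp (a * t) := h3
    _ ≤ A * Real.exp (a * t) := by gcongr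

end Gronwall

end GradVI

namespace GradVI

/-! ### Passing between slicewise, almost everywhere and pointwise bounds. -/

section AlmostEverywhere

variable {N : ℕ} {Ω : Set (Space N)} {T : ℝ}

theorem ae_ae_slice_time {p : Space N × ℝ → Prop} (h : ∀ᵐ z ∂(muCyl Ω T), p z) :
    ∀ᵐ t ∂(muTime T), ∀ᵐ x ∂(muSpace Ω), p (x, t) := by
  rw [muCyl_eq_prod] at h
  have h2 : ∀ᵐ z ∂((muTime T).prod (muSpace Ω)), p z.swap :=
    Measure.measurePreserving_swap.quasiMeasurePreserving.ae h
  exact Measure.ae_ae_of_ae_prod h2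

/-- The integral of the excess over `L` is computed slice by slice. This needs only almost
everywhere measurability of `f`. -/
theorem ae_norm_le_of_ae_ae {E : Type*} [NormedAddCommGroup E] {f : Space N × ℝ → E}
    (hf : AEStronglyMeasurable f (muCyl Ω T)) {L : ℝ}
    (h : ∀ᵐ t ∂(muTime T), ∀ᵐ x ∂(muSpace Ω), ‖f (x, t)‖ ≤ L) :
    ∀ᵐ z ∂(muCyl Ω T), ‖f z‖ ≤ L := by
  have hm : AEMeasurable (fun z => ENNReal.ofReal (‖f z‖ - L)) (muCyl Ω T) :=
    (hf.norm.aemeasurable.sub_const L).ennreal_ofReal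
  have h0 : ∫⁻ z, ENNReal.ofReal (‖f z‖ - L) ∂(muCyl Ω T) = 0 := by
    rw [muCyl_eq_prod] at hm ⊢
    rw [lintegral_prod_symm _ hm, lintegral_eq_zero_iff']
    · filter_upwards [h] with t ht
      refine (lintegral_congr_ae ?_).trans lintegral_zero
      filter_upwards [ht] with x hx
      exact ENNReal.ofReal_of_nonpos (sub_nonpos.2 hx)
    · exact hm.lintegral_prod_left'
  rw [lintegral_eq_zero_iff' hm] at h0
  filter_upwards [h0] with z hz
  exact sub_nonpos.1 (ENNReal.ofReal_eq_zero.1 hz)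

theorem ae_norm_le_of_eLpNorm_top_le {α E : Type*} [MeasurableSpace α] {μ : Measure α}
    [NormedAddCommGroup E] {f : α → E} {M : ℝ≥0} (h : eLpNorm f ∞ μ ≤ M) :
    ∀ᵐ z ∂μ, ‖f z‖ ≤ M := by
  rw [eLpNorm_exponent_top] at h
  filter_upwards [ae_le_eLpNormEssSup (f := f) (μ := μ)] with z hz
  have := hz.trans h
  rw [← ofReal_norm] at this
  exact (ENNReal.ofReal_le_coe).1 this

theorem abs_le_of_ae_ae {u : Space N × ℝ → ℝ} (hΩ : IsOpen Ω) (hT : 0 < T)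
    (hu : ContinuousOn u (closure Ω ×ˢ Icc 0 T)) {K : ℝ}
    (h : ∀ᵐ t ∂(muTime T), ∀ᵐ x ∂(muSpace Ω), |u (x, t)| ≤ K) :
    ∀ x ∈ Ω, ∀ t ∈ Icc 0 T, |u (x, t)| ≤ K := by
  have h1 : ∀ᵐ t ∂(muTime T), ∀ x ∈ Ω, |u (x, t)| ≤ K := by
    filter_upwards [h, self_mem_ae_restrict measurableSet_Ioo] with t ht htI
    have hc := (continuousOn_space hu (Ioo_subset_Icc_self htI)).abs
    -- The inequality is written as the equality `max |u| K = K`, so that uniqueness of continuous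
    -- functions equal almost everywhere applies.
    have : EqOn (fun x => max |u (x, t)| K) (fun _ => K) Ω := by
      refine Measure.eqOn_open_of_ae_eq (μ := volume) ?_ hΩ (hc.sup continuousOn_const)
        continuousOn_const
      filter_upwards [ht] with x hx using max_eq_right hx
    exact fun x hx => max_eq_right_iff.1 (this hx)
  intro x hx
  have hc := (continuousOn_time hu hx).abs
  have : EqOn (fun t => max |u (x, t)| K) (fun _ => K) (Icc 0 T) := by
    refine Measure.eqOn_Icc_of_ae_eq volume hT.ne ?_ (hc.sup continuousOn_const)
      continuousOn_const
    rw [← restrict_Ioo_eq_restrict_Icc]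
    filter_upwards [h1] with t ht using max_eq_right (ht x hx)
  exact fun t ht => max_eq_right_iff.1 (this ht)

end AlmostEverywhere

/-! ### Bounds for solutions and admissible competitors. -/

section Solution

variable {N : ℕ} {Ω : Set (Space N)} {T l m : ℝ} {M : ℝ≥0} {d : Data N}
  {u ut : Space N × ℝ → ℝ} {Du : Space N × ℝ → Space N}

/-- The gradient `Du` and the one witnessing membership in the convex set are a priori different;
uniqueness of the weak gradient identifies them. -/
theorem IsSolutionWith.ae_norm_grad_le (h : IsSolutionWith Ω T d u Du ut) (hΩ : IsOpen Ω)
    (hd : d.BoundedBy Ω T M) :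
    ∀ᵐ t ∂(muTime T), ∀ᵐ x ∂(muSpace Ω), ‖Du (x, t)‖ ≤ M := by
  filter_upwards [h.grad, h.mem_convex, ae_ae_slice_time (ae_norm_le_of_eLpNorm_top_le hd.g_le)]
    with t h1 h2 h3
  obtain ⟨G, hG, hGle⟩ := h2
  filter_upwards [h1.ae_eq hΩ hG, hGle, h3] with x e1 e2 e3
  rw [e1]
  exact e2.trans ((le_abs_self _).trans e3)

theorem IsSolutionWith.abs_le (hN : 1 ≤ N) (h : IsSolutionWith Ω T d u Du ut) (hΩ : IsOpen Ω)
    (hT : 0 < T) (hd : d.BoundedBy Ω T M) {R : ℝ} (hR : 0 ≤ R) (hΩR : Ω ⊆ Metric.ball 0 R) :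
    ∀ x ∈ Ω, ∀ t ∈ Icc 0 T, |u (x, t)| ≤ 2 * R * M := by
  refine abs_le_of_ae_ae hΩ hT h.continuousOn ?_
  filter_upwards [h.grad, h.ae_norm_grad_le hΩ hd] with t h1 h2
  exact h1.abs_le hN hR hΩ.measurableSet hΩR M.2 h2

/-- The residual `∂ₜu + b · ∇u + c u - f` of the equation. -/
noncomputable def residual (d : Data N) (u : Space N × ℝ → ℝ) (Du : Space N × ℝ → Space N)
    (ut : Space N × ℝ → ℝ) (z : Space N × ℝ) : ℝ :=
  ut z + inner ℝ (d.b z) (Du z) + d.c z * u z - d.f z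

theorem integrable_inner_of_ae_norm_le {α : Type*} [MeasurableSpace α] {μ : Measure α}
    {F G : α → Space N} (hF : Integrable F μ) (hG : AEStronglyMeasurable G μ) {L : ℝ}
    (h : ∀ᵐ z ∂μ, ‖G z‖ ≤ L) : Integrable (fun z => inner ℝ (F z) (G z)) μ := by
  refine (hF.norm.mul_const L).mono' (hF.1.inner hG) ?_
  filter_upwards [h] with z hz
  refine (norm_inner_le_norm _ _).trans ?_
  gcongr

theorem ae_abs_le_cyl {v : Space N × ℝ → ℝ} (hΩ : IsOpen Ω) {K : ℝ}
    (h : ∀ x ∈ Ω, ∀ t ∈ Icc 0 T, |v (x, t)| ≤ K) : ∀ᵐ z ∂(muCyl Ω T), ‖v z‖ ≤ K := by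
  filter_upwards [self_mem_ae_restrict (measurableSet_cyl hΩ.measurableSet T)] with z hz
  exact h z.1 hz.1 z.2 (Ioo_subset_Icc_self hz.2)

theorem ae_abs_le_of_continuousOn {v : Space N × ℝ → ℝ} (hΩ : IsOpen Ω)
    (hΩb : Bornology.IsBounded Ω) (hv : ContinuousOn v (closure Ω ×ˢ Icc 0 T)) :
    ∃ B, ∀ᵐ z ∂(muCyl Ω T), ‖v z‖ ≤ B := by
  obtain ⟨B, hB⟩ := exists_bound_of_continuousOn_closure hΩb hv
  exact ⟨B, ae_abs_le_cyl hΩ fun x hx t ht => hB (x, t) ⟨subset_closure hx, ht⟩⟩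

theorem integrable_mul_of_continuousOn {f v : Space N × ℝ → ℝ} (hΩ : IsOpen Ω)
    (hΩb : Bornology.IsBounded Ω) (hf : Integrable f (muCyl Ω T))
    (hv : ContinuousOn v (closure Ω ×ˢ Icc 0 T)) :
    Integrable (fun z => f z * v z) (muCyl Ω T) := by
  obtain ⟨B, hB⟩ := ae_abs_le_of_continuousOn hΩ hΩb hv
  exact hf.mul_bdd (aestronglyMeasurable_cyl hΩ.measurableSet hv) hB

theorem IsSolutionWith.integrable_inner (h : IsSolutionWith Ω T d u Du ut)
    {b : Space N × ℝ → Space N} (hb : Integrable b (muCyl Ω T)) :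
    Integrable (fun z => inner ℝ (b z) (Du z)) (muCyl Ω T) := by
  have hM := ae_norm_le_of_eLpNorm_top_le (M := (eLpNorm Du ∞ (muCyl Ω T)).toNNReal)
    (ENNReal.coe_toNNReal h.grad_memLp.2.ne).ge
  exact integrable_inner_of_ae_norm_le hb h.grad_memLp.1 hM

theorem Data.Admissible.integrable (hd : d.Admissible Ω T l m) (hΩb : Bornology.IsBounded Ω) :
    Integrable d.b (muCyl Ω T) ∧ Integrable d.c (muCyl Ω T) ∧ Integrable d.f (muCyl Ω T) := by
  have := isFiniteMeasure_muCyl hΩb T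
  exact ⟨hd.b_memLp.integrable (by norm_num), hd.c_memLp.integrable (by norm_num),
    hd.f_memLp.integrable (by norm_num)⟩

theorem IsSolutionWith.integrable_deriv (h : IsSolutionWith Ω T d u Du ut)
    (hΩb : Bornology.IsBounded Ω) : Integrable ut (muCyl Ω T) := by
  have := isFiniteMeasure_muCyl hΩb T
  exact h.deriv_memLp.integrable (by norm_num)

theorem IsSolutionWith.integrable_residual (h : IsSolutionWith Ω T d u Du ut)
    (hd : d.Admissible Ω T l m) (hΩ : IsOpen Ω) (hΩb : Bornology.IsBounded Ω) :
    Integrable (residual d u Du ut) (muCyl Ω T) := by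
  obtain ⟨hb, hc, hf⟩ := hd.integrable hΩb
  exact (((h.integrable_deriv hΩb).add (h.integrable_inner hb)).add
    (integrable_mul_of_continuousOn hΩ hΩb hc h.continuousOn)).sub hf

/-- The inequality holds at almost every time for all competitors at once, so the competitor may
vary with time before integrating over `(0, τ)`. -/
theorem IsSolutionWith.integral_residual_nonneg (h : IsSolutionWith Ω T d u Du ut)
    (hd : d.Admissible Ω T l m) (hΩ : IsOpen Ω) (hΩb : Bornology.IsBounded Ω)
    {v : Space N × ℝ → ℝ} (hv : ContinuousOn v (closure Ω ×ˢ Icc 0 T))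
    (hmem : ∀ᵐ t ∂(muTime T), (fun x => v (x, t)) ∈ gradConvex Ω (fun x => d.g (x, t)))
    {τ : ℝ} (hτ : τ ≤ T) :
    0 ≤ ∫ z, residual d u Du ut z * (v z - u z) ∂(muCyl Ω τ) := by
  obtain ⟨hb, hc, hf⟩ := hd.integrable hΩb
  have hq : ContinuousOn (fun z => v z - u z) (closure Ω ×ˢ Icc 0 T) := hv.sub h.continuousOn
  have hmul : ∀ {f : Space N × ℝ → ℝ}, Integrable f (muCyl Ω T) →
      Integrable (fun z => f z * (v z - u z)) (muCyl Ω T) := fun hf =>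
    integrable_mul_of_continuousOn hΩ hΩb hf hq
  have i0 := hmul (h.integrable_residual hd hΩ hΩb)
  have i1 := hmul (h.integrable_deriv hΩb)
  have i2 := hmul (h.integrable_inner hb)
  have i3 := hmul (integrable_mul_of_continuousOn hΩ hΩb hc h.continuousOn)
  have i4 := hmul hf
  have i0' := i0.mono_measure (muCyl_mono (Ω := Ω) hτ)
  rw [muCyl_eq_prod] at i0' i1 i2 i3 i4 ⊢
  rw [integral_prod_symm _ i0']
  refine integral_nonneg_of_ae ?_
  refine (Measure.absolutelyContinuous_of_le (muTime_mono hτ)).ae_le ?_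
  filter_upwards [h.ineq, hmem, i1.prod_left_ae, i2.prod_left_ae, i3.prod_left_ae,
    i4.prod_left_ae] with t ht hvt j1 j2 j3 j4
  have := ht _ hvt
  have j12 : Integrable (fun x => ut (x, t) * (v (x, t) - u (x, t)) +
      inner ℝ (d.b (x, t)) (Du (x, t)) * (v (x, t) - u (x, t))) (muSpace Ω) := j1.add j2
  have j123 : Integrable (fun x => ut (x, t) * (v (x, t) - u (x, t)) +
      inner ℝ (d.b (x, t)) (Du (x, t)) * (v (x, t) - u (x, t)) +
      d.c (x, t) * u (x, t) * (v (x, t) - u (x, t))) (muSpace Ω) := j12.add j3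
  rw [← integral_add j1 j2, ← integral_add j12 j3, ← sub_nonneg, ← integral_sub j123 j4] at this
  refine this.trans (le_of_eq ?_)
  congr 1; ext x
  simp only [residual]
  ring

/-- The inequality `m (g₁ + β) ≤ (m + β) g₁` is just `m β ≤ g₁ β`. -/
theorem Data.Admissible.smul_mem_gradConvex {d₁ d₂ : Data N} (h₁ : d₁.Admissible Ω T l m)
    (hm : 0 < m) {β : ℝ} (hβ : 0 ≤ β) (hg : ∀ᵐ z ∂(muCyl Ω T), |d₁.g z - d₂.g z| ≤ β)
    (hu : ∀ᵐ t ∂(muTime T), (fun x => u (x, t)) ∈ gradConvex Ω (fun x => d₂.g (x, t))) :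
    ∀ᵐ t ∂(muTime T),
      (fun x => m / (m + β) * u (x, t)) ∈ gradConvex Ω (fun x => d₁.g (x, t)) := by
  filter_upwards [hu, ae_ae_slice_time hg, ae_ae_slice_time h₁.g_lower] with t ht hgt hlt
  obtain ⟨G, hG, hGle⟩ := ht
  refine ⟨_, hG.const_mul (m / (m + β)), ?_⟩
  filter_upwards [hGle, hgt, hlt] with x e1 e2 e3
  have hpos : 0 < m + β := by linarith
  rw [norm_smul, Real.norm_of_nonneg (by positivity), div_mul_eq_mul_div, div_le_iff₀ hpos]
  have e4 : ‖G x‖ ≤ d₁.g (x, t) + β := by linarith [(abs_le.1 e2).1]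
  nlinarith

/-- This is the coercivity condition with test function `w²`: its gradient is `2 w ∇w`, so the
factor `½` leaves `b · ∇w w`. -/
theorem Data.Admissible.mul_integral_sq_le (hd : d.Admissible Ω T l m) (hΩ : IsOpen Ω)
    (hΩb : Bornology.IsBounded Ω) {w : Space N × ℝ → ℝ} {Dw : Space N × ℝ → Space N}
    (hw : ContinuousOn w (closure Ω ×ˢ Icc 0 T)) (hDw : AEStronglyMeasurable Dw (muCyl Ω T))
    {K L : ℝ}
    (hwK : ∀ x ∈ Ω, ∀ t ∈ Icc 0 T, |w (x, t)| ≤ K)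
    (hDwL : ∀ᵐ z ∂(muCyl Ω T), ‖Dw z‖ ≤ L)
    (hgrad : ∀ᵐ t ∂(muTime T), HasH10Gradient Ω (fun x => w (x, t)) (fun x => Dw (x, t)))
    {τ : ℝ} (hτ : τ ≤ T) :
    l * ∫ z, w z ^ 2 ∂(muCyl Ω τ) ≤
      ∫ z, (inner ℝ (d.b z) (Dw z) * w z + d.c z * w z ^ 2) ∂(muCyl Ω τ) := by
  have hfs := isFiniteMeasure_muSpace hΩb
  have hfc := isFiniteMeasure_muCyl hΩb T
  obtain ⟨hb, hc, hf⟩ := hd.integrable hΩb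
  have i1 := integrable_mul_of_continuousOn hΩ hΩb (integrable_inner_of_ae_norm_le hb hDw hDwL) hw
  have i2 := integrable_mul_of_continuousOn hΩ hΩb hc (hw.pow 2)
  have i3 : Integrable (fun z => w z ^ 2) (muCyl Ω T) := by
    simpa using integrable_mul_of_continuousOn hΩ hΩb (integrable_const (1 : ℝ)) (hw.pow 2)
  have i12 : Integrable (fun z => inner ℝ (d.b z) (Dw z) * w z + d.c z * w z ^ 2) (muCyl Ω T) :=
    i1.add i2
  have i4 : Integrable (fun z => (inner ℝ (d.b z) (Dw z) * w z + d.c z * w z ^ 2) - l * w z ^ 2)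
    (muCyl Ω T) := i12.sub (i3.const_mul l)
  have hmono := muCyl_mono (Ω := Ω) hτ
  rw [← sub_nonneg, ← integral_const_mul,
    ← integral_sub (i12.mono_measure hmono) ((i3.const_mul l).mono_measure hmono)]
  have i4' := i4.mono_measure hmono
  change 0 ≤ ∫ z, ((inner ℝ (d.b z) (Dw z) * w z + d.c z * w z ^ 2) - l * w z ^ 2) ∂(muCyl Ω τ)
  rw [muCyl_eq_prod] at i4' ⊢
  rw [integral_prod_symm _ i4']
  refine integral_nonneg_of_ae ?_
  refine (Measure.absolutelyContinuous_of_le (muTime_mono hτ)).ae_le ?_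
  filter_upwards [WeaklyCoercive.ae_nonneg hΩb hd.b_memLp hd.c_memLp hd.coercive, hgrad,
    ae_ae_slice_time hDwL, self_mem_ae_restrict measurableSet_Ioo] with t ht hgt hLt htI
  have htI' := Ioo_subset_Icc_self htI
  have hwm := aestronglyMeasurable_slice hΩ.measurableSet hw htI'
  have hwKt : ∀ᵐ x ∂(muSpace Ω), |w (x, t)| ≤ K := by
    filter_upwards [self_mem_ae_restrict hΩ.measurableSet] with x hx using hwK x hx t htI'
  have := ht (fun x => w (x, t) ^ 2) (fun x => (2 * w (x, t)) • Dw (x, t)) ?_ ?_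
    (hgt.exists_nonneg_test_tendsto_sq hwKt hLt)
  · refine this.trans (le_of_eq ?_)
    congr 1; ext x
    rw [inner_smul_right]
    ring
  · refine MemLp.of_bound (hwm.pow 2) (K ^ 2) ?_
    filter_upwards [hwKt] with x hx
    rw [norm_pow]
    exact pow_le_pow_left₀ (norm_nonneg _) hx 2
  · refine MemLp.of_bound ((hwm.const_mul 2).smul hgt.memLp_grad.1) (2 * K * L) ?_
    filter_upwards [hwKt, hLt] with x hx hx2
    rw [norm_smul, norm_mul, Real.norm_eq_abs, Real.norm_eq_abs, abs_two]
    have hK := (abs_nonneg _).trans hx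
    gcongr

end Solution

end GradVI

namespace GradVI

/-! ### The energy inequality for the difference of two solutions. -/

section Energy

variable {N : ℕ} {Ω : Set (Space N)} {T l m : ℝ} {M : ℝ≥0} {d d₁ d₂ : Data N}
  {u u₁ u₂ ut ut₁ ut₂ : Space N × ℝ → ℝ} {Du Du₁ Du₂ : Space N × ℝ → Space N}

theorem HasWeakTimeDeriv.sub (h₁ : HasWeakTimeDeriv Ω T u₁ ut₁) (h₂ : HasWeakTimeDeriv Ω T u₂ ut₂)
    (i₁ : Integrable u₁ (muCyl Ω T)) (i₂ : Integrable u₂ (muCyl Ω T))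
    (j₁ : Integrable ut₁ (muCyl Ω T)) (j₂ : Integrable ut₂ (muCyl Ω T)) :
    HasWeakTimeDeriv Ω T (fun z => u₁ z - u₂ z) (fun z => ut₁ z - ut₂ z) := by
  intro φ hφ
  obtain ⟨A, hA⟩ := hφ.compact_support.exists_bound_of_continuous hφ.smooth.continuous
  have hφm : AEStronglyMeasurable φ (muCyl Ω T) := hφ.smooth.continuous.aestronglyMeasurable
  have hder : ∀ z : Space N × ℝ, deriv (fun t => φ (z.1, t)) z.2 = fderiv ℝ φ z (0, 1) := by
    intro z
    have h1 : HasDerivAt (fun t : ℝ => (z.1, t)) ((0 : Space N), (1 : ℝ)) z.2 :=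
      (hasDerivAt_const _ _).prodMk (hasDerivAt_id _)
    exact ((hφ.smooth.differentiable (by simp) z).hasFDerivAt.comp_hasDerivAt z.2 h1).deriv
  have hc : Continuous fun z => fderiv ℝ φ z (0, 1) :=
    (hφ.smooth.continuous_fderiv (by simp)).clm_apply continuous_const
  obtain ⟨B, hB⟩ := (hφ.compact_support.fderiv_apply ℝ (0, 1)).exists_bound_of_continuous hc
  have e₁ := h₁ φ hφ
  have e₂ := h₂ φ hφ
  simp only [hder] at e₁ e₂ ⊢
  simp only [sub_mul]
  have hmulB : ∀ {f : Space N × ℝ → ℝ}, Integrable f (muCyl Ω T) →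
      Integrable (fun z => f z * fderiv ℝ φ z (0, 1)) (muCyl Ω T) := fun hf =>
    hf.mul_bdd (c := B) hc.aestronglyMeasurable (Eventually.of_forall hB)
  have hmulA : ∀ {f : Space N × ℝ → ℝ}, Integrable f (muCyl Ω T) →
      Integrable (fun z => f z * φ z) (muCyl Ω T) := fun hf =>
    hf.mul_bdd (c := A) hφm (Eventually.of_forall hA)
  rw [integral_sub (hmulB i₁) (hmulB i₂), integral_sub (hmulA j₁) (hmulA j₂), e₁, e₂]
  ring

theorem integrable_of_continuousOn (hΩ : IsOpen Ω) (hΩb : Bornology.IsBounded Ω)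
    (hu : ContinuousOn u (closure Ω ×ˢ Icc 0 T)) : Integrable u (muCyl Ω T) := by
  have := isFiniteMeasure_muCyl hΩb T
  simpa using integrable_mul_of_continuousOn hΩ hΩb (integrable_const (1 : ℝ)) hu

theorem continuousOn_integral_sq (hΩ : IsOpen Ω) (hΩb : Bornology.IsBounded Ω)
    (hu : ContinuousOn u (closure Ω ×ˢ Icc 0 T)) :
    ContinuousOn (fun t => ∫ x, u (x, t) ^ 2 ∂(muSpace Ω)) (Icc 0 T) := by
  have hfs := isFiniteMeasure_muSpace hΩb
  obtain ⟨B, hB⟩ := exists_bound_of_continuousOn_closure hΩb hu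
  refine continuousOn_of_dominated (bound := fun _ => B ^ 2) ?_ ?_ (integrable_const _) ?_
  · exact fun s hs => (aestronglyMeasurable_slice hΩ.measurableSet hu hs).pow 2
  · intro s hs
    filter_upwards [self_mem_ae_restrict hΩ.measurableSet] with x hx
    rw [norm_pow]
    exact pow_le_pow_left₀ (norm_nonneg _) (hB _ ⟨subset_closure hx, hs⟩) 2
  · filter_upwards [self_mem_ae_restrict hΩ.measurableSet] with x hx
    exact (continuousOn_time hu hx).pow 2

theorem integral_muCyl_sq (hΩ : IsOpen Ω) (hΩb : Bornology.IsBounded Ω)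
    (hu : ContinuousOn u (closure Ω ×ˢ Icc 0 T)) {τ : ℝ} (hτ : τ ∈ Icc 0 T) :
    ∫ z, u z ^ 2 ∂(muCyl Ω τ) = ∫ s in (0 : ℝ)..τ, ∫ x, u (x, s) ^ 2 ∂(muSpace Ω) := by
  have hi := (integrable_of_continuousOn hΩ hΩb (hu.pow 2)).mono_measure
    (muCyl_mono (Ω := Ω) hτ.2)
  rw [intervalIntegral.integral_of_le hτ.1, integral_Ioc_eq_integral_Ioo]
  rw [muCyl_eq_prod] at hi ⊢
  exact integral_prod_symm _ hi

theorem integral_sq_slice_le (hΩ : IsOpen Ω) (hΩb : Bornology.IsBounded Ω) {K t : ℝ}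
    (hK : ∀ x ∈ Ω, |u (x, t)| ≤ K) :
    ∫ x, u (x, t) ^ 2 ∂(muSpace Ω) ≤ K ^ 2 * (muSpace Ω).real univ := by
  have hfs := isFiniteMeasure_muSpace hΩb
  have := norm_integral_le_of_norm_le_const (μ := muSpace Ω) (f := fun x => u (x, t) ^ 2)
    (C := K ^ 2) ?_
  · exact (le_abs_self _).trans this
  · filter_upwards [self_mem_ae_restrict hΩ.measurableSet] with x hx
    rw [norm_pow]
    exact pow_le_pow_left₀ (norm_nonneg _) (hK x hx) 2

theorem abs_integral_lower_order_le {b : Space N × ℝ → Space N} {c f u v : Space N × ℝ → ℝ}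
    (hb : Integrable b (muCyl Ω T)) (hc : Integrable c (muCyl Ω T))
    (hf : Integrable f (muCyl Ω T)) {K K' L : ℝ} (hK' : 0 ≤ K')
    (hu : ∀ᵐ z ∂(muCyl Ω T), ‖u z‖ ≤ K) (hv : ∀ᵐ z ∂(muCyl Ω T), ‖v z‖ ≤ K')
    (hDu : ∀ᵐ z ∂(muCyl Ω T), ‖Du z‖ ≤ L) (hL : 0 ≤ L) (hK : 0 ≤ K) {τ : ℝ} (hτ : τ ≤ T) :
    |∫ z, (inner ℝ (b z) (Du z) + c z * u z - f z) * v z ∂(muCyl Ω τ)| ≤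
      K' * (L * ∫ z, ‖b z‖ ∂(muCyl Ω T) + K * ∫ z, ‖c z‖ ∂(muCyl Ω T) +
        ∫ z, ‖f z‖ ∂(muCyl Ω T)) := by
  have hmono := muCyl_mono (Ω := Ω) hτ
  have i1 : Integrable (fun z => L * ‖b z‖ + K * ‖c z‖) (muCyl Ω T) :=
    (hb.norm.const_mul L).add (hc.norm.const_mul K)
  have i2 : Integrable (fun z => K' * (L * ‖b z‖ + K * ‖c z‖ + ‖f z‖)) (muCyl Ω T) :=
    (i1.add hf.norm).const_mul K'
  have hle : ∀ᵐ z ∂(muCyl Ω T), ‖(inner ℝ (b z) (Du z) + c z * u z - f z) * v z‖ ≤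
      K' * (L * ‖b z‖ + K * ‖c z‖ + ‖f z‖) := by
    filter_upwards [hu, hv, hDu] with z h1 h2 h3
    rw [norm_mul, mul_comm]
    have h4 : ‖inner ℝ (b z) (Du z)‖ ≤ L * ‖b z‖ := by
      rw [mul_comm]
      exact (norm_inner_le_norm _ _).trans (by gcongr)
    have h5 : ‖c z * u z‖ ≤ K * ‖c z‖ := by
      rw [norm_mul, mul_comm]; gcongr
    have h6 : ‖inner ℝ (b z) (Du z) + c z * u z - f z‖ ≤ L * ‖b z‖ + K * ‖c z‖ + ‖f z‖ :=
      (norm_sub_le _ _).trans (by linarith [norm_add_le (inner ℝ (b z) (Du z)) (c z * u z)])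
    exact mul_le_mul h2 h6 (norm_nonneg _) hK'
  calc |∫ z, (inner ℝ (b z) (Du z) + c z * u z - f z) * v z ∂(muCyl Ω τ)|
      ≤ ∫ z, K' * (L * ‖b z‖ + K * ‖c z‖ + ‖f z‖) ∂(muCyl Ω τ) :=
        norm_integral_le_of_norm_le (i2.mono_measure hmono)
          ((Measure.absolutelyContinuous_of_le hmono).ae_le hle)
    _ ≤ ∫ z, K' * (L * ‖b z‖ + K * ‖c z‖ + ‖f z‖) ∂(muCyl Ω T) :=
        integral_mono_measure hmono (Eventually.of_forall fun z => by
          simp only [Pi.zero_apply]; positivity) i2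
    _ = _ := by
        rw [integral_const_mul, integral_add i1 hf.norm,
          integral_add (hb.norm.const_mul L) (hc.norm.const_mul K), integral_const_mul,
          integral_const_mul]

/-- Each solution is tested with the scaled copy of the other. Here `κ` bounds the lower-order part
of each solution's own energy, so `β / m` times a constant is the cost of scaling. -/
theorem energy_inequality (hΩ : IsOpen Ω) (hΩb : Bornology.IsBounded Ω) (hT : 0 < T)
    (hm : 0 < m) (ha₁ : d₁.Admissible Ω T l m) (ha₂ : d₂.Admissible Ω T l m)
    (h₁ : IsSolutionWith Ω T d₁ u₁ Du₁ ut₁) (h₂ : IsSolutionWith Ω T d₂ u₂ Du₂ ut₂)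
    {K L β κ : ℝ} (hK : 0 ≤ K) (hL : 0 ≤ L) (hβ : 0 ≤ β)
    (hu₁ : ∀ x ∈ Ω, ∀ t ∈ Icc 0 T, |u₁ (x, t)| ≤ K)
    (hu₂ : ∀ x ∈ Ω, ∀ t ∈ Icc 0 T, |u₂ (x, t)| ≤ K)
    (hDu₁ : ∀ᵐ z ∂(muCyl Ω T), ‖Du₁ z‖ ≤ L) (hDu₂ : ∀ᵐ z ∂(muCyl Ω T), ‖Du₂ z‖ ≤ L)
    (hg : ∀ᵐ z ∂(muCyl Ω T), |d₁.g z - d₂.g z| ≤ β)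
    (hκ₁ : K * (L * ∫ z, ‖d₁.b z‖ ∂(muCyl Ω T) + K * ∫ z, ‖d₁.c z‖ ∂(muCyl Ω T) +
      ∫ z, ‖d₁.f z‖ ∂(muCyl Ω T)) ≤ κ)
    (hκ₂ : K * (L * ∫ z, ‖d₂.b z‖ ∂(muCyl Ω T) + K * ∫ z, ‖d₂.c z‖ ∂(muCyl Ω T) +
      ∫ z, ‖d₂.f z‖ ∂(muCyl Ω T)) ≤ κ) {τ : ℝ} (hτ : τ ∈ Icc 0 T) :
    ∫ x, (u₁ (x, τ) - u₂ (x, τ)) ^ 2 ∂(muSpace Ω) ≤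
      (∫ x, (u₁ (x, 0) - u₂ (x, 0)) ^ 2 ∂(muSpace Ω) +
        2 * (2 * K * (L * ∫ z, ‖d₁.b z - d₂.b z‖ ∂(muCyl Ω T) +
          K * ∫ z, ‖d₁.c z - d₂.c z‖ ∂(muCyl Ω T) + ∫ z, ‖d₁.f z - d₂.f z‖ ∂(muCyl Ω T))) +
        β / m * (2 * K ^ 2 * (muSpace Ω).real univ + 4 * κ)) +
      2 * |l| * ∫ s in (0 : ℝ)..τ, ∫ x, (u₁ (x, s) - u₂ (x, s)) ^ 2 ∂(muSpace Ω) := by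
  have hmono := muCyl_mono (Ω := Ω) hτ.2
  obtain ⟨hb₁, hc₁, hf₁⟩ := ha₁.integrable hΩb
  obtain ⟨hb₂, hc₂, hf₂⟩ := ha₂.integrable hΩb
  have hut₁ := h₁.integrable_deriv hΩb
  have hut₂ := h₂.integrable_deriv hΩb
  have c₁ := h₁.continuousOn
  have c₂ := h₂.continuousOn
  set w : Space N × ℝ → ℝ := fun z => u₁ z - u₂ z with hw
  set Dw : Space N × ℝ → Space N := fun z => Du₁ z - Du₂ z with hDw
  have cw : ContinuousOn w (closure Ω ×ˢ Icc 0 T) := c₁.sub c₂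
  have hwK : ∀ x ∈ Ω, ∀ t ∈ Icc 0 T, |w (x, t)| ≤ 2 * K := fun x hx t ht =>
    (abs_sub _ _).trans (by linarith [hu₁ x hx t ht, hu₂ x hx t ht])
  have hDwm : AEStronglyMeasurable Dw (muCyl Ω T) := h₁.grad_memLp.1.sub h₂.grad_memLp.1
  have hDwL : ∀ᵐ z ∂(muCyl Ω T), ‖Dw z‖ ≤ 2 * L := by
    filter_upwards [hDu₁, hDu₂] with z e1 e2
    exact (norm_sub_le _ _).trans (by linarith)
  have hgradw : ∀ᵐ t ∂(muTime T),
      HasH10Gradient Ω (fun x => w (x, t)) (fun x => Dw (x, t)) := by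
    filter_upwards [h₁.grad, h₂.grad] with t e1 e2 using e1.sub e2
  set lam : ℝ := m / (m + β) with hlam
  have hmβ : 0 < m + β := by linarith
  have hlam0 : 0 < lam := by positivity
  -- After division by `lam`, the terms created by the scaling carry the factor `β / m`.
  have hlam1 : 1 - lam = lam * (β / m) := by rw [hlam]; field_simp; ring
  have hg' : ∀ᵐ z ∂(muCyl Ω T), |d₂.g z - d₁.g z| ≤ β := by
    filter_upwards [hg] with z hz
    rwa [abs_sub_comm]
  have t₁ := h₁.integral_residual_nonneg ha₁ hΩ hΩb (v := fun z => lam * u₂ z)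
    (continuousOn_const.mul c₂) (ha₁.smul_mem_gradConvex hm hβ hg h₂.mem_convex) hτ.2
  have t₂ := h₂.integral_residual_nonneg ha₂ hΩ hΩb (v := fun z => lam * u₁ z)
    (continuousOn_const.mul c₁) (ha₂.smul_mem_gradConvex hm hβ hg' h₁.mem_convex) hτ.2
  have hI : ∀ {f v : Space N × ℝ → ℝ}, Integrable f (muCyl Ω T) →
      ContinuousOn v (closure Ω ×ˢ Icc 0 T) → Integrable (fun z => f z * v z) (muCyl Ω τ) :=
    fun hf hv => (integrable_mul_of_continuousOn hΩ hΩb hf hv).mono_measure hmono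
  have iadd : ∀ {f g : Space N × ℝ → ℝ}, Integrable f (muCyl Ω τ) → Integrable g (muCyl Ω τ) →
      Integrable (fun z => f z + g z) (muCyl Ω τ) := fun hf hg => hf.add hg
  have iP₁ := hI (v := fun z => lam * u₂ z - u₁ z) (h₁.integrable_residual ha₁ hΩ hΩb)
    ((continuousOn_const.mul c₂).sub c₁)
  have iP₂ := hI (v := fun z => lam * u₁ z - u₂ z) (h₂.integrable_residual ha₂ hΩ hΩb)
    ((continuousOn_const.mul c₁).sub c₂)
  have iE : Integrable (fun z => (ut₁ z - ut₂ z) * w z) (muCyl Ω τ) := hI (hut₁.sub hut₂) cw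
  have ik : Integrable (fun z => inner ℝ (d₁.b z) (Dw z) * w z + d₁.c z * w z ^ 2)
      (muCyl Ω τ) :=
    (hI (integrable_inner_of_ae_norm_le hb₁ hDwm hDwL) cw).add (hI hc₁ (cw.pow 2))
  have ilow : ∀ {b : Space N × ℝ → Space N} {c f u v : Space N × ℝ → ℝ}
      {Du : Space N × ℝ → Space N}, Integrable b (muCyl Ω T) → Integrable c (muCyl Ω T) →
      Integrable f (muCyl Ω T) → AEStronglyMeasurable Du (muCyl Ω T) →
      (∀ᵐ z ∂(muCyl Ω T), ‖Du z‖ ≤ L) → ContinuousOn u (closure Ω ×ˢ Icc 0 T) →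
      ContinuousOn v (closure Ω ×ˢ Icc 0 T) →
      Integrable (fun z => (inner ℝ (b z) (Du z) + c z * u z - f z) * v z) (muCyl Ω τ) :=
    fun hb hc hf hDm hDL hu hv => hI (((integrable_inner_of_ae_norm_le hb hDm hDL).add
      (integrable_mul_of_continuousOn hΩ hΩb hc hu)).sub hf) hv
  have ir : Integrable (fun z => (inner ℝ (d₁.b z - d₂.b z) (Du₂ z) +
      (d₁.c z - d₂.c z) * u₂ z - (d₁.f z - d₂.f z)) * w z) (muCyl Ω τ) :=
    ilow (hb₁.sub hb₂) (hc₁.sub hc₂) (hf₁.sub hf₂) h₂.grad_memLp.1 hDu₂ c₂ cw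
  have iE₁ := hI hut₁ c₁
  have iE₂ := hI hut₂ c₂
  have iq₁ := ilow hb₁ hc₁ hf₁ h₁.grad_memLp.1 hDu₁ c₁ c₁
  have iq₂ := ilow hb₂ hc₂ hf₂ h₂.grad_memLp.1 hDu₂ c₂ c₂
  -- The algebra is `r₁ (λu₂ - u₁) + r₂ (λu₁ - u₂) = -λ (r₁ - r₂)(u₁ - u₂) - (1 - λ)(r₁u₁ + r₂u₂)`.
  -- In `r₁ - r₂`, the coefficients `b₁`, `c₁` act on `w` and the coefficient differences act on
  -- `u₂`.
  have hsum : (∫ z, residual d₁ u₁ Du₁ ut₁ z * (lam * u₂ z - u₁ z) ∂(muCyl Ω τ)) +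
      ∫ z, residual d₂ u₂ Du₂ ut₂ z * (lam * u₁ z - u₂ z) ∂(muCyl Ω τ) =
      -(lam * (∫ z, (ut₁ z - ut₂ z) * w z ∂(muCyl Ω τ) +
          ∫ z, (inner ℝ (d₁.b z) (Dw z) * w z + d₁.c z * w z ^ 2) ∂(muCyl Ω τ) +
          ∫ z, (inner ℝ (d₁.b z - d₂.b z) (Du₂ z) +
            (d₁.c z - d₂.c z) * u₂ z - (d₁.f z - d₂.f z)) * w z ∂(muCyl Ω τ)) +
        (1 - lam) * ((∫ z, ut₁ z * u₁ z ∂(muCyl Ω τ) +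
          ∫ z, (inner ℝ (d₁.b z) (Du₁ z) + d₁.c z * u₁ z - d₁.f z) * u₁ z ∂(muCyl Ω τ)) +
          (∫ z, ut₂ z * u₂ z ∂(muCyl Ω τ) +
          ∫ z, (inner ℝ (d₂.b z) (Du₂ z) + d₂.c z * u₂ z - d₂.f z) * u₂ z ∂(muCyl Ω τ)))) := by
    have iX := iadd (iadd iE ik) ir
    have iY := iadd (iadd iE₁ iq₁) (iadd iE₂ iq₂)
    rw [← integral_add iP₁ iP₂, ← integral_add iE ik, ← integral_add (iadd iE ik) ir,
      ← integral_add iE₁ iq₁, ← integral_add iE₂ iq₂,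
      ← integral_add (iadd iE₁ iq₁) (iadd iE₂ iq₂), ← integral_const_mul, ← integral_const_mul,
      ← integral_add (iX.const_mul _) (iY.const_mul _), ← integral_neg]
    congr 1; ext z
    simp only [residual, hw, hDw, inner_sub_left, inner_sub_right]
    ring
  have hww := h₁.weakDeriv.sub h₂.weakDeriv (integrable_of_continuousOn hΩ hΩb c₁)
    (integrable_of_continuousOn hΩ hΩb c₂) hut₁ hut₂
  have en := integral_sq_sub_integral_sq hΩ hΩb hT cw (hut₁.sub hut₂) hww hτ
  have en₁ := integral_sq_sub_integral_sq hΩ hΩb hT c₁ hut₁ h₁.weakDeriv hτ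
  have en₂ := integral_sq_sub_integral_sq hΩ hΩb hT c₂ hut₂ h₂.weakDeriv hτ
  have h0 : (0 : ℝ) ∈ Icc 0 T := left_mem_Icc.2 hT.le
  have s₁ := integral_sq_slice_le hΩ hΩb fun x hx => hu₁ x hx 0 h0
  have s₂ := integral_sq_slice_le hΩ hΩb fun x hx => hu₂ x hx 0 h0
  have p₁ : 0 ≤ ∫ x, u₁ (x, τ) ^ 2 ∂(muSpace Ω) := integral_nonneg fun x => sq_nonneg _
  have p₂ : 0 ≤ ∫ x, u₂ (x, τ) ^ 2 ∂(muSpace Ω) := integral_nonneg fun x => sq_nonneg _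
  have co := ha₁.mul_integral_sq_le hΩ hΩb cw hDwm hwK hDwL hgradw hτ.2
  have pw : 0 ≤ ∫ z, w z ^ 2 ∂(muCyl Ω τ) := integral_nonneg fun x => sq_nonneg _
  have co' : -(|l| * ∫ z, w z ^ 2 ∂(muCyl Ω τ)) ≤ l * ∫ z, w z ^ 2 ∂(muCyl Ω τ) := by
    rw [← neg_mul]
    exact mul_le_mul_of_nonneg_right (neg_abs_le l) pw
  have r₀ := abs_integral_lower_order_le (hb₁.sub hb₂) (hc₁.sub hc₂) (hf₁.sub hf₂)
    (by positivity : 0 ≤ 2 * K) (ae_abs_le_cyl hΩ hu₂) (ae_abs_le_cyl hΩ hwK) hDu₂ hL hK hτ.2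
  have r₁ := abs_integral_lower_order_le hb₁ hc₁ hf₁ hK (ae_abs_le_cyl hΩ hu₁)
    (ae_abs_le_cyl hΩ hu₁) hDu₁ hL hK hτ.2
  have r₂ := abs_integral_lower_order_le hb₂ hc₂ hf₂ hK (ae_abs_le_cyl hΩ hu₂)
    (ae_abs_le_cyl hΩ hu₂) hDu₂ hL hK hτ.2
  have r₀' := (abs_le.1 r₀).1
  have r₁' := (abs_le.1 (r₁.trans hκ₁)).1
  have r₂' := (abs_le.1 (r₂.trans hκ₂)).1
  simp only [Pi.sub_apply] at r₀' en
  rw [integral_muCyl_sq hΩ hΩb cw hτ] at co co'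
  have tot := hsum ▸ add_nonneg t₁ t₂
  rw [hlam1] at tot
  set V := (muSpace Ω).real univ
  have hβm : 0 ≤ β / m := by positivity
  set X := (∫ z, (ut₁ z - ut₂ z) * w z ∂(muCyl Ω τ) +
          ∫ z, (inner ℝ (d₁.b z) (Dw z) * w z + d₁.c z * w z ^ 2) ∂(muCyl Ω τ) +
          ∫ z, (inner ℝ (d₁.b z - d₂.b z) (Du₂ z) +
            (d₁.c z - d₂.c z) * u₂ z - (d₁.f z - d₂.f z)) * w z ∂(muCyl Ω τ)) with hX
  set Y := ((∫ z, ut₁ z * u₁ z ∂(muCyl Ω τ) +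
          ∫ z, (inner ℝ (d₁.b z) (Du₁ z) + d₁.c z * u₁ z - d₁.f z) * u₁ z ∂(muCyl Ω τ)) +
          (∫ z, ut₂ z * u₂ z ∂(muCyl Ω τ) +
          ∫ z, (inner ℝ (d₂.b z) (Du₂ z) + d₂.c z * u₂ z - d₂.f z) * u₂ z ∂(muCyl Ω τ))) with hY
  have hXY : X + β / m * Y ≤ 0 := by
    have : lam * (X + β / m * Y) ≤ 0 := by linarith
    exact nonpos_of_mul_nonpos_right this hlam0
  -- Each `∫ ∂ₜuᵢ uᵢ` is at least minus half the initial `∫ uᵢ²`, that is `-K²V/2`, and each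
  -- lower-order integral is at least `-κ`.
  have hYle : -(K ^ 2 * V + 2 * κ) ≤ Y := by rw [hY]; linarith
  have hYm := mul_le_mul_of_nonneg_left hYle hβm
  change ∫ x, w (x, τ) ^ 2 ∂(muSpace Ω) ≤ (∫ x, w (x, 0) ^ 2 ∂(muSpace Ω) + _ + _) +
    2 * |l| * ∫ s in (0 : ℝ)..τ, ∫ x, w (x, s) ^ 2 ∂(muSpace Ω)
  have hfin : β / m * (2 * K ^ 2 * V + 4 * κ) = 2 * (β / m * (K ^ 2 * V + 2 * κ)) := by ring
  rw [hfin]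
  rw [mul_neg] at hYm
  linarith

end Energy

end GradVI

namespace GradVI

/-! ### Conversion to extended norms and the final constant. -/

section Norms

variable {α E : Type*} [MeasurableSpace α] {μ : Measure α} [NormedAddCommGroup E]

theorem eLpNorm_one_eq_ofReal_integral_norm {f : α → E} (hf : Integrable f μ) :
    eLpNorm f 1 μ = ENNReal.ofReal (∫ x, ‖f x‖ ∂μ) := by
  rw [eLpNorm_one_eq_lintegral_enorm, ofReal_integral_norm_eq_lintegral_enorm hf]

theorem eLpNorm_two_sq_eq_ofReal_integral_sq {f : α → ℝ} (hf : MemLp f 2 μ) :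
    eLpNorm f 2 μ ^ 2 = ENNReal.ofReal (∫ x, f x ^ 2 ∂μ) := by
  have h := eLpNorm_nnreal_pow_eq_lintegral (f := f) (μ := μ) (p := 2) (by norm_num)
  simp only [NNReal.coe_ofNat, ENNReal.coe_ofNat, ENNReal.rpow_ofNat] at h
  rw [h, ofReal_integral_eq_lintegral_ofReal hf.integrable_sq
    (Eventually.of_forall fun x => sq_nonneg _)]
  congr 1; ext x
  rw [← sq_abs, ENNReal.ofReal_pow (abs_nonneg _), ← Real.norm_eq_abs, ofReal_norm]

theorem integral_norm_le_of_eLpNorm_two_le [IsFiniteMeasure μ] {f : α → E} (hf : MemLp f 2 μ)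
    {M : ℝ≥0} (h : eLpNorm f 2 μ ≤ M) :
    ∫ x, ‖f x‖ ∂μ ≤
      ((M : ℝ≥0∞) * μ univ ^ (1 / (1 : ℝ≥0∞).toReal - 1 / (2 : ℝ≥0∞).toReal)).toReal := by
  have hi : Integrable f μ := hf.integrable (by norm_num)
  have hfin : (M : ℝ≥0∞) * μ univ ^ (1 / (1 : ℝ≥0∞).toReal - 1 / (2 : ℝ≥0∞).toReal) ≠ ⊤ :=
    ENNReal.mul_ne_top ENNReal.coe_ne_top
      (ENNReal.rpow_ne_top_of_nonneg (by norm_num) (measure_ne_top _ _))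
  rw [← ENNReal.ofReal_le_iff_le_toReal hfin, ← eLpNorm_one_eq_ofReal_integral_norm hi]
  refine (eLpNorm_le_eLpNorm_mul_rpow_measure_univ (q := 2) (by norm_num) hf.1).trans ?_
  gcongr

end Norms

theorem normLinfL2_sq_le {N : ℕ} {Ω : Set (Space N)} {T : ℝ} {w : Space N × ℝ → ℝ} {S : ℝ≥0∞}
    (h : ∀ᵐ t ∂(muTime T), eLpNorm (fun x => w (x, t)) 2 (muSpace Ω) ^ 2 ≤ S) :
    normLinfL2 Ω T w ^ 2 ≤ S := by
  have h1 : normLinfL2 Ω T w ≤ S ^ ((2 : ℝ)⁻¹) := by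
    refine essSup_le_of_ae_le _ ?_
    filter_upwards [h] with t ht
    rw [ENNReal.le_rpow_inv_iff (by norm_num), ENNReal.rpow_ofNat]
    exact ht
  rwa [ENNReal.le_rpow_inv_iff (by norm_num), ENNReal.rpow_ofNat] at h1

end GradVI

theorem theorem3p2 {N : ℕ} (hN : 1 ≤ N) (Ω : Set (Space N)) (hΩ : IsOpen Ω)
    (hΩb : Bornology.IsBounded Ω) (T : ℝ) (hT : 0 < T) (l m : ℝ) (hm : 0 < m) (M : ℝ≥0) :
    ∃ C : ℝ, 0 < C ∧
      ∀ (d₁ d₂ : Data N) (u₁ u₂ : Space N × ℝ → ℝ),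
        d₁.Admissible Ω T l m → d₂.Admissible Ω T l m →
        d₁.BoundedBy Ω T M → d₂.BoundedBy Ω T M →
        IsSolution Ω T d₁ u₁ → IsSolution Ω T d₂ u₂ →
        normLinfL2 Ω T (u₁ - u₂) ^ 2 ≤
          ENNReal.ofReal C *
            (eLpNorm (d₁.u0 - d₂.u0) 2 (muSpace Ω) ^ 2
              + eLpNorm (d₁.b - d₂.b) 1 (muCyl Ω T)
              + eLpNorm (d₁.c - d₂.c) 1 (muCyl Ω T)
              + eLpNorm (d₁.f - d₂.f) 1 (muCyl Ω T)
              + eLpNorm (d₁.g - d₂.g) ∞ (muCyl Ω T)) := by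
  obtain ⟨R, hR, hΩR⟩ := hΩb.subset_ball_lt 0 0
  have hfs := isFiniteMeasure_muSpace hΩb
  have hfc := isFiniteMeasure_muCyl hΩb T
  set K : ℝ := 2 * R * M
  have hK : 0 ≤ K := by positivity
  set V : ℝ := (muSpace Ω).real univ
  -- Hölder's bound for the `L¹` norms of `b`, `c`, `f` in terms of their `L²` bound `M`.
  set B : ℝ := ((M : ℝ≥0∞) * (muCyl Ω T) univ ^
    (1 / (1 : ℝ≥0∞).toReal - 1 / (2 : ℝ≥0∞).toReal)).toReal
  have hB : 0 ≤ B := ENNReal.toReal_nonneg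
  have hV : 0 ≤ V := measureReal_nonneg
  set κ : ℝ := K * (M * B + K * B + B)
  have hκ : 0 ≤ κ := by positivity
  -- The sum dominates every coefficient of the energy inequality: `1` for the initial data, `4KM`,
  -- `4K²`, `4K` for `b`, `c`, `f`, and the last term for `g`. Gronwall contributes the exponential.
  set C₀ : ℝ := 1 + 4 * K * (M + K + 1) + (2 * K ^ 2 * V + 4 * κ) / m
  refine ⟨C₀ * Real.exp (2 * |l| * T), by positivity, ?_⟩
  intro d₁ d₂ u₁ u₂ ha₁ ha₂ hb₁ hb₂ hs₁ hs₂
  obtain ⟨Du₁, ut₁, h₁⟩ := hs₁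
  obtain ⟨Du₂, ut₂, h₂⟩ := hs₂
  obtain ⟨ib₁, ic₁, if₁⟩ := ha₁.integrable hΩb
  obtain ⟨ib₂, ic₂, if₂⟩ := ha₂.integrable hΩb
  have hgm : MemLp (d₁.g - d₂.g) ∞ (muCyl Ω T) := ha₁.g_W1Inf.memLp.sub ha₂.g_W1Inf.memLp
  set β : ℝ≥0 := (eLpNorm (d₁.g - d₂.g) ∞ (muCyl Ω T)).toNNReal
  have hβ : eLpNorm (d₁.g - d₂.g) ∞ (muCyl Ω T) = ENNReal.ofReal β := by
    rw [ENNReal.ofReal_coe_nnreal, ENNReal.coe_toNNReal hgm.2.ne]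
  have hg : ∀ᵐ z ∂(muCyl Ω T), |d₁.g z - d₂.g z| ≤ β :=
    ae_norm_le_of_eLpNorm_top_le (ENNReal.coe_toNNReal hgm.2.ne).ge
  have c₁ := h₁.continuousOn
  have c₂ := h₂.continuousOn
  have cw : ContinuousOn (fun z => u₁ z - u₂ z) (closure Ω ×ˢ Icc 0 T) := c₁.sub c₂
  have hκle : ∀ d : Data N, d.Admissible Ω T l m → d.BoundedBy Ω T M →
      K * (M * ∫ z, ‖d.b z‖ ∂(muCyl Ω T) + K * ∫ z, ‖d.c z‖ ∂(muCyl Ω T) +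
        ∫ z, ‖d.f z‖ ∂(muCyl Ω T)) ≤ κ := by
    intro d ha hb
    have e1 := integral_norm_le_of_eLpNorm_two_le ha.b_memLp hb.b_le
    have e2 := integral_norm_le_of_eLpNorm_two_le ha.c_memLp hb.c_le
    have e3 := integral_norm_le_of_eLpNorm_two_le ha.f_memLp hb.f_le
    simp only [κ]
    gcongr
  set y : ℝ → ℝ := fun t => ∫ x, (u₁ (x, t) - u₂ (x, t)) ^ 2 ∂(muSpace Ω)
  set nb : ℝ := ∫ z, ‖d₁.b z - d₂.b z‖ ∂(muCyl Ω T)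
  set nc : ℝ := ∫ z, ‖d₁.c z - d₂.c z‖ ∂(muCyl Ω T)
  set nf : ℝ := ∫ z, ‖d₁.f z - d₂.f z‖ ∂(muCyl Ω T)
  have hnb : 0 ≤ nb := integral_nonneg fun z => norm_nonneg _
  have hnc : 0 ≤ nc := integral_nonneg fun z => norm_nonneg _
  have hnf : 0 ≤ nf := integral_nonneg fun z => norm_nonneg _
  have hy : ∀ t, 0 ≤ y t := fun t => integral_nonneg fun z => sq_nonneg _
  have hgron := le_mul_exp_of_le_add_integral (a := 2 * |l|) (by positivity)
    (continuousOn_integral_sq hΩ hΩb cw) fun τ hτ =>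
      energy_inequality hΩ hΩb hT hm ha₁ ha₂ h₁ h₂ hK M.2 β.2
        (h₁.abs_le hN hΩ hT hb₁ hR.le hΩR) (h₂.abs_le hN hΩ hT hb₂ hR.le hΩR)
        (ae_norm_le_of_ae_ae h₁.grad_memLp.1 (h₁.ae_norm_grad_le hΩ hb₁))
        (ae_norm_le_of_ae_ae h₂.grad_memLp.1 (h₂.ae_norm_grad_le hΩ hb₂))
        hg (hκle d₁ ha₁ hb₁) (hκle d₂ ha₂ hb₂) hτ
  have hA : y 0 + 2 * (2 * K * (M * nb + K * nc + nf)) +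
      β / m * (2 * K ^ 2 * V + 4 * κ) ≤ C₀ * (y 0 + nb + nc + nf + β) := by
    have hq : 0 ≤ (2 * K ^ 2 * V + 4 * κ) / m := by positivity
    have hM : (0 : ℝ) ≤ M := M.2
    have k0 : 1 * y 0 ≤ C₀ * y 0 :=
      mul_le_mul_of_nonneg_right (by simp only [C₀]; nlinarith [mul_nonneg hK hM]) (hy 0)
    have k1 : 4 * K * M * nb ≤ C₀ * nb :=
      mul_le_mul_of_nonneg_right (by simp only [C₀]; nlinarith) hnb
    have k2 : 4 * K * K * nc ≤ C₀ * nc :=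
      mul_le_mul_of_nonneg_right (by simp only [C₀]; nlinarith [mul_nonneg hK hM]) hnc
    have k3 : 4 * K * nf ≤ C₀ * nf :=
      mul_le_mul_of_nonneg_right (by simp only [C₀]; nlinarith [mul_nonneg hK hM]) hnf
    have k4 : (2 * K ^ 2 * V + 4 * κ) / m * β ≤ C₀ * β :=
      mul_le_mul_of_nonneg_right (by simp only [C₀]; nlinarith [mul_nonneg hK hM]) β.2
    have k5 : (β : ℝ) / m * (2 * K ^ 2 * V + 4 * κ) = (2 * K ^ 2 * V + 4 * κ) / m * β := by ring
    rw [k5]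
    linarith
  have hsl : ∀ t ∈ Icc 0 T, MemLp (fun x => u₁ (x, t) - u₂ (x, t)) 2 (muSpace Ω) := by
    intro t ht
    obtain ⟨D, hD⟩ := exists_bound_of_continuousOn_closure hΩb cw
    refine MemLp.of_bound (aestronglyMeasurable_slice hΩ.measurableSet cw ht) D ?_
    filter_upwards [self_mem_ae_restrict hΩ.measurableSet] with x hx
    exact hD (x, t) ⟨subset_closure hx, ht⟩
  have hu0 : eLpNorm (d₁.u0 - d₂.u0) 2 (muSpace Ω) ^ 2 = ENNReal.ofReal (y 0) := by
    rw [← eLpNorm_two_sq_eq_ofReal_integral_sq (hsl 0 (left_mem_Icc.2 hT.le))]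
    congr 1
    refine eLpNorm_congr_ae ?_
    filter_upwards [h₁.initial, h₂.initial] with x e1 e2
    rw [e1, e2, Pi.sub_apply]
  refine normLinfL2_sq_le ?_
  rw [hu0, eLpNorm_one_eq_ofReal_integral_norm (ib₁.sub ib₂),
    eLpNorm_one_eq_ofReal_integral_norm (ic₁.sub ic₂),
    eLpNorm_one_eq_ofReal_integral_norm (if₁.sub if₂), hβ]
  change ∀ᵐ t ∂(muTime T), _ ≤ _ * (_ + ENNReal.ofReal nb + ENNReal.ofReal nc +
    ENNReal.ofReal nf + _)
  have hy0 := hy 0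
  rw [← ENNReal.ofReal_add hy0 hnb, ← ENNReal.ofReal_add (by positivity) hnc,
    ← ENNReal.ofReal_add (by positivity) hnf, ← ENNReal.ofReal_add (by positivity) β.coe_nonneg,
    ← ENNReal.ofReal_mul (by positivity)]
  filter_upwards [self_mem_ae_restrict measurableSet_Ioo] with t ht
  have ht' := Ioo_subset_Icc_self ht
  refine (eLpNorm_two_sq_eq_ofReal_integral_sq (hsl t ht')).le.trans
    (ENNReal.ofReal_le_ofReal ?_)
  refine (hgron t ht').trans ?_
  rw [mul_right_comm C₀]
  refine mul_le_mul hA (Real.exp_le_exp.2 ?_) (Real.exp_nonneg _) (by positivity)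
  exact mul_le_mul_of_nonneg_left ht'.2 (by positivity)
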